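/- Let $n\ge 1$ and let $f\in\mathbb{C}[x_1,\dots,x_n]$ be weighted homogeneous with respect to positive rational weights $w_1,\dots,w_n$, such that $V(f)$ has an isolated singularity at the origin. Let $\mathcal{O}=\mathbb{C}[[x_1,\dots,x_n]]$ with maximal ideal $m$, let $f_i=\partial f/\partial x_i$, $J(f)=(f_1,\dots,f_n)\subseteq\mathcal{O}$, and put $\mu_k=\dim_{\mathbb{C}}\mathcal{O}/m^kJ(f)$ and $\tau_k=\dim_{\mathbb{C}}\mathcal{O}/(f,m^kJ(f))$ for $k\ge 0$. Let $m_i$ be the multiplicity (order) of $f_i$ and $m_{i,j}=\min\{m_i,m_j\}$. Let $K_1=\bigoplus_i\mathcal{O}e_i$ and $K_2=\bigoplus_{i<j}\mathcal{O}\,e_i\wedge e_j$, with the Koszul differential $d:K_2\to K_1$, $d(e_i\wedge e_j)=f_ie_j-f_je_i$, filtered by $$F^qK_1=\bigoplus_i m^q e_i,\qquad F^pK_2=\bigoplus_{i<j}m^{p-m_{i,j}}\,e_i\wedge e_j,$$ where $m^a=\mathcal{O}$ for $a\le 0$. For $p,L\ge 0$ let $Z_L^p\subseteq F^pK_2/F^{p+1}K_2$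 be the image of $\{a\in F^pK_2: da\in F^{p+L}K_1\}$ (the cycles of degree $p$ and level at least $L$), and let $Z_\infty^p$ be the image of $\{a\in F^pK_2:da=0\}$. Set $$\mathbb{Z}_\infty(t)=\sum_{p\ge 0}\dim_{\mathbb{C}}(Z_\infty^p)\,t^p,\qquad \mathbb{H}_L(t)=\sum_{p\ge 0}\dim_{\mathbb{C}}\bigl(Z_L^p/Z_{L+1}^p\bigr)\,t^p,$$ and call $L\ge 1$ a gap number of $f$ if $Z_L^p\ne Z_{L+1}^p$ for some $p$. Then all the dimensions above are finite, $f$ has only finitely many gap numbers $L_1,\dots,L_s$, and in $\mathbb{Q}[[t]]$ $$\sum_{k\ge 0}\mu_kt^k=\frac{t}{(1-t)^{n+1}}\Bigl(n-\sum_{i<j}t^{m_{i,j}}\Bigr)+\frac{\mu_0+\mathbb{Z}_\infty(t)\,t}{1-t}+\sum_{i=1}^{s}\frac{t-t^{L_i+1}}{1-t}\,\mathbb{H}_{L_i}(t),$$ $$\sum_{k\ge 0}\tau_kt^k=\frac{t}{(1-t)^{n+1}}\Bigl(n-t-\sum_{i<j}t^{m_{i,j}}\Bigr)+\frac{\mu_0+\mathbb{Z}_\infty(t)\,t}{1-t}+\sum_{i=1}^{s}\frac{t-t^{L_i+1}}{1-t}\,\mathbb{H}_{L_i}(t).$$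 -/

import Mathlib

open scoped Topology

noncomputable section

namespace KthTjurina

/-- The formal power series ring `ℂ[[x₁, …, xₙ]]`. -/
abbrev O (n : ℕ) : Type := MvPowerSeries (Fin n) ℂ

/-- The maximal ideal of `ℂ[[x₁, …, xₙ]]`. -/
abbrev maxIdeal (n : ℕ) : Ideal (O n) := IsLocalRing.maximalIdeal (O n)

variable {n : ℕ}

/-- The point `x` is a singular point of `V(f)`. -/
def IsSingularPoint (f : MvPolynomial (Fin n) ℂ) (x : Fin n → ℂ) : Prop :=
  MvPolynomial.eval x f = 0 ∧ ∀ i, MvPolynomial.eval x (MvPolynomial.pderiv i f) = 0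

/-- `V(f)` has an isolated singularity at the origin: the origin is a singular point, and
no other point of some neighbourhood of the origin is one. -/
def HasIsolatedSingularity (f : MvPolynomial (Fin n) ℂ) : Prop :=
  IsSingularPoint f 0 ∧ ∀ᶠ x in 𝓝[≠] (0 : Fin n → ℂ), ¬ IsSingularPoint f x

/-- The partial derivative `f_i = ∂f/∂x_i` in the power series ring. -/
def partialD (f : MvPolynomial (Fin n) ℂ) (i : Fin n) : O n :=
  ((MvPolynomial.pderiv i f : MvPolynomial (Fin n) ℂ) : MvPowerSeries (Fin n) ℂ)

/-- The Jacobi ideal `J(f) = (f₁, …, fₙ)`. -/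
def jacobiIdeal (f : MvPolynomial (Fin n) ℂ) : Ideal (O n) :=
  Ideal.span (Set.range (partialD f))

/-- The `k`-th Milnor algebra `O / m^k J(f)`. -/
abbrev MilnorAlgebra (f : MvPolynomial (Fin n) ℂ) (k : ℕ) : Type :=
  O n ⧸ (maxIdeal n ^ k * jacobiIdeal f)

/-- The `k`-th Tjurina algebra `O / (f, m^k J(f))`. -/
abbrev TjurinaAlgebra (f : MvPolynomial (Fin n) ℂ) (k : ℕ) : Type :=
  O n ⧸ (Ideal.span {(f : MvPowerSeries (Fin n) ℂ)} ⊔ maxIdeal n ^ k * jacobiIdeal f)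

/-- The `k`-th Milnor number `μ_k`. -/
def milnorNumber (f : MvPolynomial (Fin n) ℂ) (k : ℕ) : ℕ :=
  Module.finrank ℂ (MilnorAlgebra f k)

/-- The `k`-th Tjurina number `τ_k`. -/
def tjurinaNumber (f : MvPolynomial (Fin n) ℂ) (k : ℕ) : ℕ :=
  Module.finrank ℂ (TjurinaAlgebra f k)

/-- The series `∑ μ_k t^k`. -/
def milnorSeries (f : MvPolynomial (Fin n) ℂ) : PowerSeries ℚ :=
  PowerSeries.mk fun k => (milnorNumber f k : ℚ)

/-- The series `∑ τ_k t^k`. -/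
def tjurinaSeries (f : MvPolynomial (Fin n) ℂ) : PowerSeries ℚ :=
  PowerSeries.mk fun k => (tjurinaNumber f k : ℚ)

/-- The multiplicity `m_i` of `f_i`, i.e. the least total degree of a monomial of `f_i`
(no `f_i` vanishes if `V(f)` has an isolated singularity). -/
def mult (f : MvPolynomial (Fin n) ℂ) (i : Fin n) : ℕ :=
  (MvPowerSeries.order (partialD f i)).toNat

/-- The index set `{(i, j) : i < j}` of the basis `e_i ∧ e_j` of the Koszul 2-chains. -/
abbrev Pairs (n : ℕ) : Type := {p : Fin n × Fin n // p.1 < p.2}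

/-- `m_{i,j} = min {m_i, m_j}`. -/
def multPair (f : MvPolynomial (Fin n) ℂ) (p : Pairs n) : ℕ :=
  min (mult f p.1.1) (mult f p.1.2)

/-- The Koszul differential from the 2-chains `⊕_{i<j} O e_i ∧ e_j` to the 1-chains `⊕_i O e_i`
of `(f₁, …, fₙ)`, with `e_i ∧ e_j ↦ f_i e_j - f_j e_i`. -/
def koszulD (f : MvPolynomial (Fin n) ℂ) : (Pairs n → O n) →ₗ[O n] (Fin n → O n) :=
  ∑ p : Pairs n, (LinearMap.proj p).smulRight
    (Pi.single p.1.2 (partialD f p.1.1) - Pi.single p.1.1 (partialD f p.1.2))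

/-- The filtration `⊕_i m^q e_i` of the 1-chains: each `e_i` has degree `0`. -/
def filOne (n : ℕ) (q : ℕ) : Submodule (O n) (Fin n → O n) :=
  Submodule.pi Set.univ fun _ => maxIdeal n ^ q

/-- The filtration of the 2-chains in which `e_i ∧ e_j` has degree `m_{i,j}`; in degree `d` it is
`⊕_{i<j} m^{d - m_{i,j}} e_i ∧ e_j`, where `m^a` is the whole ring for `a ≤ 0`. -/
def filTwo (f : MvPolynomial (Fin n) ℂ) (d : ℕ) : Submodule (O n) (Pairs n → O n) :=
  Submodule.pi Set.univ fun p => maxIdeal n ^ (d - multPair f p)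

/-- The degree `d` part of the associated graded module of the 2-chains. -/
abbrev GrTwo (f : MvPolynomial (Fin n) ℂ) (d : ℕ) : Type :=
  filTwo f d ⧸ (filTwo f (d + 1)).submoduleOf (filTwo f d)

/-- Cycles of level at least `L` in degree `d`: the classes in `GrTwo f d` of the 2-chains of
filtration degree `d` whose differential has filtration degree at least `d + L`. -/
def levelCycles (f : MvPolynomial (Fin n) ℂ) (L d : ℕ) : Submodule (O n) (GrTwo f d) :=
  (((filOne n (d + L)).comap (koszulD f)).submoduleOf (filTwo f d)).map (Submodule.mkQ _)

/-- Cycles of infinite level in degree `d`: the classes in `GrTwo f d` of the honest Koszul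
2-cycles of filtration degree `d`. -/
def limitCycles (f : MvPolynomial (Fin n) ℂ) (d : ℕ) : Submodule (O n) (GrTwo f d) :=
  ((LinearMap.ker (koszulD f)).submoduleOf (filTwo f d)).map (Submodule.mkQ _)

/-- The part of level exactly `L` in degree `d`. -/
abbrev LevelHomology (f : MvPolynomial (Fin n) ℂ) (L d : ℕ) : Type :=
  levelCycles f L d ⧸ (levelCycles f (L + 1) d).submoduleOf (levelCycles f L d)

/-- The Hilbert-Poincaré series `ℤ_∞(t)` of the cycles of infinite level. -/
def limitSeries (f : MvPolynomial (Fin n) ℂ) : PowerSeries ℚ :=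
  PowerSeries.mk fun d => (Module.finrank ℂ (limitCycles f d) : ℚ)

/-- The Hilbert-Poincaré series `ℍ_L(t)` of the part of level exactly `L`. -/
def levelSeries (f : MvPolynomial (Fin n) ℂ) (L : ℕ) : PowerSeries ℚ :=
  PowerSeries.mk fun d => (Module.finrank ℂ (LevelHomology f L d) : ℚ)

/-- The gap numbers: the positive levels that occur. -/
def gapNumbers (f : MvPolynomial (Fin n) ℂ) : Set ℕ :=
  {L | 1 ≤ L ∧ ∃ d, Nontrivial (LevelHomology f L d)}

end KthTjurina

end

noncomputable section

namespace KthTjurina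

/-! ### Power series by order, and division by powers of the variables. -/

section

variable {n : ℕ}

/-! Put two filtrations on the Koszul 2-chains: `filTwo` by degree `p`, and the preimage under
`koszulD` of the filtration `filOne` by `q`. Let `h(p,q)` be the dimension of the bigraded piece
(`bigradedDim`). The part of exact level `L` in degree `p` has dimension `h(p, p+L)`
(`finrank_levelHomology`), so the same numbers can be summed in two directions.

With `p` fixed, they add up, together with the infinite-level cycles, to the graded pieces of the
2-chains. Writing `G = 1/(1-t)^n` for the Hilbert series of the ring, this says `∑_L H_L + Z_∞ = G ∑
t^(m_{i,j})` (`sum_levelSeries_add_limitSeries`). With `q` fixed, they add up to the graded pieces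
of the image of `koszulD`, whose Hilbert series is therefore `∑_L t^L H_L` (`boundarySeries_eq`). By
exactness this image is the kernel of the map from 1-chains onto `J(f)`. That map carries `⊕ m^k
e_i` onto `m^k J(f)`, so `(1-t) ∑ μ_k t^k = μ_0 + t (n G - ∑_L t^L H_L)` (`milnorSeries_mul`).
Eliminating `∑_L H_L` gives the first formula.

Finiteness of the levels needs exactness with control of the order: a relation in `m^q` bounds a
2-chain in `m^(q-nN)` (`exists_koszulD_eq`), so a cycle of level above `nN` agrees with an honest
cycle in the graded module. Here `N` satisfies `x_i^N ∈ J(f)` for all `i`. It comes from the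
Nullstellensatz, since the weighted scaling action spreads any nonzero critical point to critical
points arbitrarily near the origin.

For `τ_k`, Euler's identity gives `f ∈ m J(f)`, and orders give `(m^(k+1) J(f) : f) = m^k`. Hence
`μ_(k+1) - τ_(k+1) = dim O/m^k`, which accounts for the extra `-t`. -/

theorem mem_maxIdeal_iff {g : O n} : g ∈ maxIdeal n ↔ MvPowerSeries.constantCoeff g = 0 := by
  rw [IsLocalRing.mem_maximalIdeal, mem_nonunits_iff, MvPowerSeries.isUnit_iff_constantCoeff,
    isUnit_iff_ne_zero, not_not]

theorem X_mem_maxIdeal (i : Fin n) : (MvPowerSeries.X i : O n) ∈ maxIdeal n := by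
  rw [mem_maxIdeal_iff, MvPowerSeries.constantCoeff_X]

/-- Division of a power series by a power of a variable. -/
theorem exists_eq_X_pow_mul_add (i : Fin n) (N : ℕ) (g : O n) :
    ∃ v r : O n, g = MvPowerSeries.X i ^ N * v + r ∧
      (∀ e, MvPowerSeries.coeff e v = MvPowerSeries.coeff (Finsupp.single i N + e) g) ∧
      (∀ e, MvPowerSeries.coeff e r = if e i < N then MvPowerSeries.coeff e g else 0) := by
  obtain ⟨v, hv⟩ : ∃ v : O n, ∀ e, MvPowerSeries.coeff e v =
      MvPowerSeries.coeff (Finsupp.single i N + e) g := ⟨fun e => _, fun e => rfl⟩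
  obtain ⟨r, hr⟩ : ∃ r : O n, ∀ e, MvPowerSeries.coeff e r =
      if e i < N then MvPowerSeries.coeff e g else 0 := ⟨fun e => _, fun e => rfl⟩
  refine ⟨v, r, ?_, hv, hr⟩
  ext e
  rw [map_add, MvPowerSeries.X_pow_eq, MvPowerSeries.coeff_monomial_mul, hr]
  simp only [Finsupp.single_le_iff]
  by_cases h : N ≤ e i
  · have : Finsupp.single i N + (e - Finsupp.single i N) = e :=
      add_tsub_cancel_of_le (Finsupp.single_le_iff.2 h)
    simp [h, hv, this]
  · simp [h, not_le.1 h]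

/-- The power series each of whose monomials is divisible by the `N`-th power of one of the first
`d` variables. -/
def boxIdeal (n d N : ℕ) : Ideal (O n) where
  carrier := {g | ∀ e, MvPowerSeries.coeff e g ≠ 0 → ∃ i : Fin n, i.1 < d ∧ N ≤ e i}
  add_mem' {a b} ha hb e he := by
    by_cases h : MvPowerSeries.coeff e a = 0
    · exact hb e fun h' => he (by rw [map_add, h, h', add_zero])
    · exact ha e h
  zero_mem' e he := (he (map_zero _)).elim
  smul_mem' c g hg e he := by
    rw [smul_eq_mul, MvPowerSeries.coeff_mul] at he
    obtain ⟨x, hx, hx'⟩ := Finset.exists_ne_zero_of_sum_ne_zero he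
    obtain ⟨i, hi, hN⟩ := hg x.2 (right_ne_zero_of_mul hx')
    refine ⟨i, hi, hN.trans ?_⟩
    rw [← Finset.HasAntidiagonal.mem_antidiagonal.1 hx]
    simp

theorem boxIdeal_zero (N : ℕ) : boxIdeal n 0 N = ⊥ := by
  rw [eq_bot_iff]
  intro g hg
  rw [Ideal.mem_bot]
  ext e
  by_contra h
  obtain ⟨i, hi, -⟩ := hg e h
  exact absurd hi (Nat.not_lt_zero _)

theorem boxIdeal_mono {d d' : ℕ} (h : d ≤ d') (N : ℕ) : boxIdeal n d N ≤ boxIdeal n d' N :=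
  fun _ hg e he => let ⟨i, hi, hN⟩ := hg e he; ⟨i, hi.trans_le h, hN⟩

theorem X_pow_mem_boxIdeal (i : Fin n) (N : ℕ) :
    (MvPowerSeries.X i ^ N : O n) ∈ boxIdeal n (i + 1) N := by
  intro e he
  classical
  rw [MvPowerSeries.coeff_X_pow] at he
  have : e = Finsupp.single i N := by by_contra h; exact he (if_neg h)
  exact ⟨i, Nat.lt_succ_self _, by simp [this]⟩

/-- Multiplying by `x_i` leaves the exponents of the earlier variables unchanged, so `x_i^N` is a
nonzerodivisor modulo the `N`-th powers of those variables. -/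
theorem mem_boxIdeal_of_X_pow_mul_mem {i : Fin n} {N : ℕ} {g : O n}
    (h : MvPowerSeries.X i ^ N * g ∈ boxIdeal n i N) : g ∈ boxIdeal n i N := by
  intro e he
  obtain ⟨j, hj, hN⟩ := h (Finsupp.single i N + e) (by
    rwa [MvPowerSeries.X_pow_eq, MvPowerSeries.coeff_add_monomial_mul, one_mul])
  refine ⟨j, hj, ?_⟩
  have : j ≠ i := fun h => by simp [h] at hj
  simpa [Finsupp.single_apply, this.symm] using hN

/-- The power series without monomials of degree less than `q`. -/
theorem mem_maxIdeal_pow {q : ℕ} {g : O n} : g ∈ maxIdeal n ^ q ↔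
    ∀ e : Fin n →₀ ℕ, e.degree < q → MvPowerSeries.coeff e g = 0 := by
  constructor
  · intro hg
    suffices h : (q : ℕ∞) ≤ g.order from fun e he =>
      MvPowerSeries.coeff_of_lt_order (lt_of_lt_of_le (by exact_mod_cast he) h)
    induction q generalizing g with
    | zero => simp
    | succ q ih =>
      rw [pow_succ] at hg
      refine Submodule.mul_induction_on hg (fun a ha b hb => ?_) (fun a b ha hb => ?_)
      · refine le_trans ?_ MvPowerSeries.le_order_mul
        push_cast
        exact add_le_add (ih ha) (MvPowerSeries.one_le_order_iff_constCoeff_eq_zero.2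
          (mem_maxIdeal_iff.1 hb))
      · exact (le_min ha hb).trans MvPowerSeries.min_order_le_add
  · induction q generalizing g with
    | zero => simp
    | succ q ih =>
      intro hg
      -- Induction on the number `d` of variables allowed to divide the monomials. Splitting off one
      -- variable leaves a cofactor of order at least `q`, to which the outer induction applies, and
      -- a remainder that needs one variable fewer.
      have key : ∀ d ≤ n, ∀ g : O n, (∀ e : Fin n →₀ ℕ, e.degree < q + 1 →
          MvPowerSeries.coeff e g = 0) → g ∈ boxIdeal n d 1 → g ∈ maxIdeal n ^ (q + 1) := by
        intro d
        induction d with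
        | zero =>
          intro _ g _ hg
          rw [boxIdeal_zero, Ideal.mem_bot] at hg
          rw [hg]; exact zero_mem _
        | succ d ihd =>
          intro hd g h1 h2
          obtain ⟨v, r, hgr, hv, hr⟩ := exists_eq_X_pow_mul_add ⟨d, hd⟩ 1 g
          rw [hgr]
          refine add_mem ?_ (ihd (Nat.le_of_succ_le hd) r (fun e he => ?_) (fun e he => ?_))
          · rw [pow_succ', pow_one]
            refine Ideal.mul_mem_mul (X_mem_maxIdeal _) (ih fun e he => ?_)
            rw [hv]
            apply h1
            rw [map_add, Finsupp.degree_single]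
            omega
          · rw [hr, h1 e he, ite_self]
          · rw [hr] at he
            have h3 : e ⟨d, hd⟩ < 1 := by by_contra h; exact he (if_neg h)
            rw [if_pos h3] at he
            obtain ⟨i, hi, hi'⟩ := h2 e he
            refine ⟨i, ?_, hi'⟩
            rcases Nat.lt_succ_iff_lt_or_eq.1 hi with h | h
            · exact h
            · have : i = ⟨d, hd⟩ := Fin.ext h
              rw [this] at hi'
              omega
      refine key n le_rfl g hg fun e he => ?_
      -- A monomial divisible by no variable is the constant one, which the hypothesis on degrees
      -- excludes.
      by_contra! h
      refine he (hg e ?_)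
      have : e = 0 := by
        ext i
        have := h i i.2
        simpa using this
      simp [this]

theorem mem_maxIdeal_pow_iff_le_order {q : ℕ} {g : O n} :
    g ∈ maxIdeal n ^ q ↔ (q : ℕ∞) ≤ g.order := by
  rw [mem_maxIdeal_pow]
  exact ⟨fun h => MvPowerSeries.nat_le_order fun d hd => h d hd,
    fun h e he => MvPowerSeries.coeff_of_lt_order (lt_of_lt_of_le (by exact_mod_cast he) h)⟩

/-- Splitting off the multiples of a power of one more variable, with control of the order. -/
theorem exists_eq_X_pow_mul_add_of_mem_boxIdeal (i : Fin n) (N q : ℕ) {g : O n}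
    (hg : g ∈ boxIdeal n (i + 1) N) (hq : g ∈ maxIdeal n ^ q) :
    ∃ v r : O n, g = MvPowerSeries.X i ^ N * v + r ∧ v ∈ maxIdeal n ^ (q - N) ∧
      r ∈ boxIdeal n i N := by
  obtain ⟨v, r, hgr, hv, hr⟩ := exists_eq_X_pow_mul_add i N g
  refine ⟨v, r, hgr, ?_, fun e he => ?_⟩
  · rw [mem_maxIdeal_pow] at hq ⊢
    intro e he
    rw [hv]
    apply hq
    rw [map_add, Finsupp.degree_single]
    omega
  · rw [hr] at he
    have h3 : e i < N := by by_contra h; exact he (if_neg h)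
    rw [if_pos h3] at he
    obtain ⟨j, hj, hj'⟩ := hg e he
    refine ⟨j, ?_, hj'⟩
    rcases Nat.lt_succ_iff_lt_or_eq.1 hj with h | h
    · exact h
    · have : j = i := Fin.ext h
      rw [this] at hj'
      omega

end

/-! ### The full Koszul complex and its exactness with bounded loss of order. -/

section

variable {n : ℕ}

section Koszul

variable {R : Type*} [CommRing R]

/-- The sign of moving `e_j` to its place in `e_S`. -/
def wedgeSign (R : Type*) [CommRing R] (j : Fin n) (S : Finset (Fin n)) : R :=
  (-1) ^ (S.filter (· < j)).card

theorem wedgeSign_insert {j k : Fin n} {S : Finset (Fin n)} (hk : k ∉ S) :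
    wedgeSign R j (insert k S) = (if k < j then -1 else 1) * wedgeSign R j S := by
  unfold wedgeSign
  rw [Finset.filter_insert]
  split_ifs with h
  · rw [Finset.card_insert_of_notMem (by simp [hk]), pow_succ']
  · rw [one_mul]

theorem wedgeSign_mul_self (j : Fin n) (S : Finset (Fin n)) :
    wedgeSign R j S * wedgeSign R j S = 1 := by
  unfold wedgeSign
  rw [← mul_pow, neg_one_mul, neg_neg, one_pow]

/-- Contraction with the `j`-th coordinate on the exterior algebra of `R^n`, an element of which is
given by its coefficients at the basis elements `e_S`. -/
def contract (R : Type*) [CommRing R] (j : Fin n) :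
    (Finset (Fin n) → R) →ₗ[R] (Finset (Fin n) → R) where
  toFun z S := if j ∈ S then 0 else wedgeSign R j S * z (insert j S)
  map_add' x y := by
    ext S; simp only [Pi.add_apply]; split_ifs <;> ring
  map_smul' c x := by
    ext S; simp only [Pi.smul_apply, smul_eq_mul, RingHom.id_apply]; split_ifs <;> ring

/-- Exterior multiplication with `e_j`. -/
def wedge (R : Type*) [CommRing R] (j : Fin n) :
    (Finset (Fin n) → R) →ₗ[R] (Finset (Fin n) → R) where
  toFun z S := if j ∈ S then wedgeSign R j S * z (S.erase j) else 0
  map_add' x y := by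
    ext S; simp only [Pi.add_apply]; split_ifs <;> ring
  map_smul' c x := by
    ext S; simp only [Pi.smul_apply, smul_eq_mul, RingHom.id_apply]; split_ifs <;> ring

theorem contract_apply (j : Fin n) (z : Finset (Fin n) → R) (S : Finset (Fin n)) :
    contract R j z S = if j ∈ S then 0 else wedgeSign R j S * z (insert j S) := rfl

theorem wedge_apply (j : Fin n) (z : Finset (Fin n) → R) (S : Finset (Fin n)) :
    wedge R j z S = if j ∈ S then wedgeSign R j S * z (S.erase j) else 0 := rfl

theorem contract_contract (j k : Fin n) (z : Finset (Fin n) → R) :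
    contract R j (contract R k z) = -contract R k (contract R j z) := by
  ext S
  simp only [Pi.neg_apply, contract_apply, Finset.mem_insert]
  by_cases hj : j ∈ S
  · simp [hj]
  by_cases hk : k ∈ S
  · simp [hk]
  by_cases hjk : j = k
  · simp [hjk]
  rw [if_neg hj, if_neg (by tauto), if_neg hk, if_neg (by tauto), wedgeSign_insert hj,
    wedgeSign_insert hk, Finset.insert_comm]
  rcases lt_or_gt_of_ne hjk with h | h
  · rw [if_pos h, if_neg h.not_gt]; ring
  · rw [if_neg h.not_gt, if_pos h]; ring

theorem contract_wedge_self (j : Fin n) (z : Finset (Fin n) → R) :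
    contract R j (wedge R j z) = z - wedge R j (contract R j z) := by
  ext S
  simp only [Pi.sub_apply, contract_apply, wedge_apply]
  by_cases hj : j ∈ S
  · have h : wedgeSign R j (S.erase j) = wedgeSign R j S := by
      conv_rhs => rw [← Finset.insert_erase hj]
      rw [wedgeSign_insert (Finset.notMem_erase _ _), if_neg (lt_irrefl _), one_mul]
    rw [if_pos hj, if_pos hj, if_neg (Finset.notMem_erase _ _), Finset.insert_erase hj, h,
      ← mul_assoc, wedgeSign_mul_self, one_mul, sub_self]
  · rw [if_neg hj, if_pos (Finset.mem_insert_self _ _), if_neg hj, Finset.erase_insert hj,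
      wedgeSign_insert hj, if_neg (lt_irrefl _), one_mul, ← mul_assoc, wedgeSign_mul_self]
    ring

theorem contract_wedge_of_ne {j k : Fin n} (hjk : j ≠ k) (z : Finset (Fin n) → R) :
    contract R j (wedge R k z) = -wedge R k (contract R j z) := by
  ext S
  simp only [Pi.neg_apply, contract_apply, wedge_apply]
  by_cases hk : k ∈ S
  · obtain ⟨T, hT, rfl⟩ : ∃ T, k ∉ T ∧ insert k T = S :=
      ⟨S.erase k, Finset.notMem_erase _ _, Finset.insert_erase hk⟩
    by_cases hj : j ∈ T
    · simp [hj, hT]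
    · rw [if_neg (by simp [hj, hjk]), if_pos (by simp), if_pos (by simp), Finset.erase_insert hT,
        if_neg hj, Finset.insert_comm, Finset.erase_insert (by simp [hT, hjk.symm]),
        wedgeSign_insert hT, wedgeSign_insert (j := k) (by simp [hT, hjk.symm]),
        wedgeSign_insert (j := k) hT, wedgeSign_insert (j := k) hj, if_neg (lt_irrefl k)]
      rcases lt_or_gt_of_ne hjk with h | h
      · rw [if_pos h, if_neg h.not_gt]; ring
      · rw [if_neg h.not_gt, if_pos h]; ring
  · simp [hk, hjk.symm]

/-- The Koszul differential of a sequence. -/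
def koszul (f : Fin n → R) : (Finset (Fin n) → R) →ₗ[R] (Finset (Fin n) → R) :=
  ∑ j, f j • contract R j

/-- Exterior multiplication with a vector. -/
def wedgeVec (c : Fin n → R) : (Finset (Fin n) → R) →ₗ[R] (Finset (Fin n) → R) :=
  ∑ j, c j • wedge R j

theorem koszul_eq (f : Fin n → R) (z : Finset (Fin n) → R) :
    koszul f z = ∑ j, f j • contract R j z := by
  simp [koszul, LinearMap.sum_apply]

theorem wedgeVec_eq (f : Fin n → R) (z : Finset (Fin n) → R) :
    wedgeVec f z = ∑ j, f j • wedge R j z := by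
  simp [wedgeVec, LinearMap.sum_apply]

/-- Contractions anticommute, so exchanging the two summations shows that the square equals its own
negative; absence of torsion then makes it vanish. -/
theorem koszul_koszul [IsAddTorsionFree R] (f : Fin n → R) (z : Finset (Fin n) → R) :
    koszul f (koszul f z) = 0 := by
  have h : koszul f (koszul f z) = -koszul f (koszul f z) := by
    conv_lhs => simp only [koszul_eq, map_sum, map_smul, Finset.smul_sum]
    rw [Finset.sum_comm]
    simp only [koszul_eq, map_sum, map_smul, Finset.smul_sum, ← Finset.sum_neg_distrib]
    refine Finset.sum_congr rfl fun j _ => Finset.sum_congr rfl fun k _ => ?_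
    rw [contract_contract, smul_neg, smul_neg, smul_comm]
  exact self_eq_neg.1 h

/-- The homotopy formula, from the Clifford relations between contraction and exterior
multiplication. When `∑ c_j f_j = x_i^N`, wedging with `c` is a contracting homotopy up to the
factor `x_i^N`. -/
theorem koszul_wedgeVec (f c : Fin n → R) (z : Finset (Fin n) → R) :
    koszul f (wedgeVec c z) = (∑ j, c j * f j) • z - wedgeVec c (koszul f z) := by
  have h : ∀ j k, contract R j (wedge R k z) =
      (if j = k then z else 0) - wedge R k (contract R j z) := by
    intro j k
    split_ifs with hjk
    · rw [hjk, contract_wedge_self]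
    · rw [contract_wedge_of_ne hjk, zero_sub]
  simp only [koszul_eq, wedgeVec_eq, map_sum, map_smul, Finset.smul_sum, h, smul_sub,
    Finset.sum_sub_distrib, Finset.sum_smul]
  congr 1
  · refine Finset.sum_congr rfl fun j _ => ?_
    rw [Finset.sum_eq_single j (fun k _ hk => by rw [if_neg hk, smul_zero, smul_zero])
      (by simp), if_pos rfl, smul_smul, mul_comm]
  · rw [Finset.sum_comm]
    exact Finset.sum_congr rfl fun j _ => Finset.sum_congr rfl fun k _ => smul_comm _ _ _

theorem koszul_mem (f : Fin n → R) (I : Ideal R) {z : Finset (Fin n) → R} (hz : ∀ S, z S ∈ I)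
    (S : Finset (Fin n)) : koszul f z S ∈ I := by
  rw [koszul_eq, Finset.sum_apply]
  refine sum_mem fun j _ => I.mul_mem_left _ ?_
  rw [contract_apply]
  split_ifs
  · exact zero_mem _
  · exact I.mul_mem_left _ (hz _)

theorem wedgeVec_mem (f : Fin n → R) (I : Ideal R) {z : Finset (Fin n) → R} (hz : ∀ S, z S ∈ I)
    (S : Finset (Fin n)) : wedgeVec f z S ∈ I := by
  rw [wedgeVec_eq, Finset.sum_apply]
  refine sum_mem fun j _ => I.mul_mem_left _ ?_
  rw [wedge_apply]
  split_ifs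
  · exact I.mul_mem_left _ (hz _)
  · exact zero_mem _

theorem card_eq_of_wedgeVec_ne_zero (c : Fin n → R) {i : ℕ} {z : Finset (Fin n) → R}
    (hz : ∀ S, z S ≠ 0 → S.card = i) (S : Finset (Fin n)) (hS : wedgeVec c z S ≠ 0) :
    S.card = i + 1 := by
  rw [wedgeVec_eq, Finset.sum_apply] at hS
  obtain ⟨j, -, hj⟩ := Finset.exists_ne_zero_of_sum_ne_zero hS
  rw [Pi.smul_apply, wedge_apply] at hj
  split_ifs at hj with h
  · have h1 := hz (S.erase j) fun h0 => hj (by rw [h0, mul_zero, smul_zero])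
    rw [← h1, Finset.card_erase_add_one h]
  · exact (hj (smul_zero _)).elim

end Koszul

instance : IsAddTorsionFree (O n) where
  nsmul_right_injective m hm a b h := by
    ext e
    have h1 : m • MvPowerSeries.coeff e a = m • MvPowerSeries.coeff e b := by
      rw [← map_nsmul, ← map_nsmul]
      exact congrArg (MvPowerSeries.coeff e) h
    exact nsmul_right_injective hm h1

/-- Acyclicity of the Koszul complex in degrees above `d` modulo the `N`-th powers of the first `d`
variables, with control of the order, for a sequence whose ideal contains the `N`-th powers of all
variables. -/
theorem exists_koszul_sub_mem_boxIdeal (f : Fin n → O n) (N : ℕ) (c : Fin n → Fin n → O n)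
    (hc : ∀ i, ∑ j, c i j * f j = MvPowerSeries.X i ^ N) (k : ℕ) :
    ∀ d, d + k = n → ∀ (q i : ℕ) (z : Finset (Fin n) → O n), d < i →
      (∀ S, z S ≠ 0 → S.card = i) → (∀ S, z S ∈ maxIdeal n ^ q) →
      (∀ S, koszul f z S ∈ boxIdeal n d N) →
      ∃ u : Finset (Fin n) → O n, (∀ S, u S ∈ maxIdeal n ^ (q - k * N)) ∧
        ∀ S, z S - koszul f u S ∈ boxIdeal n d N := by
  induction k with
  | zero =>
    intro d hd q i z hi hz _ _
    refine ⟨0, fun S => zero_mem _, fun S => ?_⟩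
    -- Here `d = n`, and there are no nonzero chains of degree above `n`.
    have : z S = 0 := by
      by_contra h
      have h1 := hz S h
      have h2 := S.card_le_univ
      rw [Fintype.card_fin] at h2
      omega
    rw [map_zero, this, Pi.zero_apply, sub_zero]
    exact zero_mem _
  | succ k ih =>
    intro d hd q i z hi hz hq hbox
    have hdn : d < n := by omega
    set j : Fin n := ⟨d, hdn⟩ with hj
    have hkos := koszul_wedgeVec f (c j) z
    rw [hc] at hkos
    -- By the homotopy formula `c_j ∧ z` is a cycle modulo one more variable, and its degree rises
    -- along with `d`. The induction thus gives `c_j ∧ z = ∂u + x_j^N v + r` with `r` in the smaller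
    -- box ideal. Applying `∂` puts `x_j^N (z - ∂v)` in that ideal, and `x_j^N` cancels. Each
    -- division by `x_j^N` costs `N` in the order.
    obtain ⟨u, hu, hu'⟩ := ih (d + 1) (by omega) q (i + 1) (wedgeVec (c j) z) (by omega)
      (card_eq_of_wedgeVec_ne_zero _ hz) (wedgeVec_mem _ _ hq) (fun S => by
        rw [hkos]
        refine sub_mem (Ideal.mul_mem_right _ _ (X_pow_mem_boxIdeal j N)) ?_
        exact boxIdeal_mono (Nat.le_succ d) N (wedgeVec_mem _ _ hbox S))
    have hsplit : ∀ S, ∃ v r : O n, wedgeVec (c j) z S - koszul f u S =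
        MvPowerSeries.X j ^ N * v + r ∧ v ∈ maxIdeal n ^ (q - k * N - N) ∧ r ∈ boxIdeal n d N :=
      fun S => exists_eq_X_pow_mul_add_of_mem_boxIdeal j N _ (hu' S)
        (sub_mem (Ideal.pow_le_pow_right (Nat.sub_le _ _) (wedgeVec_mem _ _ hq S))
          (koszul_mem _ _ hu S))
    choose v r hvr hv hr using hsplit
    refine ⟨v, fun S => ?_, fun S => ?_⟩
    · rw [Nat.succ_mul, ← Nat.sub_sub]
      exact hv S
    · refine mem_boxIdeal_of_X_pow_mul_mem (i := j) ?_
      have h1 : wedgeVec (c j) z = koszul f u + ((MvPowerSeries.X j ^ N : O n) • v + r) := by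
        ext1 S
        rw [Pi.add_apply, Pi.add_apply, Pi.smul_apply, smul_eq_mul, ← hvr]
        ring
      have h2 : MvPowerSeries.X j ^ N * (z S - koszul f v S) =
          wedgeVec (c j) (koszul f z) S + koszul f r S := by
        have h3 := congrFun hkos S
        rw [h1, map_add, map_add, koszul_koszul, map_smul, zero_add] at h3
        simp only [Pi.add_apply, Pi.smul_apply, Pi.sub_apply, smul_eq_mul] at h3
        linear_combination -h3
      rw [h2]
      exact add_mem (wedgeVec_mem _ _ hbox S) (koszul_mem _ _ hr S)

/-- Exactness of the Koszul complex, with control of the order. -/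
theorem exists_koszul_eq (f : Fin n → O n) (N : ℕ) (c : Fin n → Fin n → O n)
    (hc : ∀ i, ∑ j, c i j * f j = MvPowerSeries.X i ^ N) {q i : ℕ} (hi : 0 < i)
    {z : Finset (Fin n) → O n} (hz : ∀ S, z S ≠ 0 → S.card = i)
    (hq : ∀ S, z S ∈ maxIdeal n ^ q) (h0 : koszul f z = 0) :
    ∃ u : Finset (Fin n) → O n, (∀ S, u S ∈ maxIdeal n ^ (q - n * N)) ∧ koszul f u = z := by
  obtain ⟨u, hu, hu'⟩ := exists_koszul_sub_mem_boxIdeal f N c hc n 0 (zero_add n) q i z hi hz hq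
    (fun S => by rw [h0]; exact zero_mem _)
  refine ⟨u, hu, ?_⟩
  ext1 S
  have := hu' S
  rw [boxIdeal_zero, Ideal.mem_bot, sub_eq_zero] at this
  exact this.symm

end

/-! ### Exactness at the 1-chains in terms of `koszulD`. -/

section

variable {n : ℕ}

theorem koszulD_apply (f : MvPolynomial (Fin n) ℂ) (v : Pairs n → O n) (k : Fin n) :
    koszulD f v k = ∑ p : Pairs n, v p *
      ((if k = p.1.2 then partialD f p.1.1 else 0) -
        (if k = p.1.1 then partialD f p.1.2 else 0)) := by
  simp only [koszulD, LinearMap.sum_apply, LinearMap.smulRight_apply, LinearMap.proj_apply,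
    Finset.sum_apply, Pi.smul_apply, Pi.sub_apply, smul_eq_mul, Pi.single_apply]

theorem sum_pairs {M : Type*} [AddCommMonoid M] (g : Fin n → Fin n → M) :
    ∑ p : Pairs n, g p.1.1 p.1.2 = ∑ a, ∑ b, if a < b then g a b else 0 := by
  rw [← Fintype.sum_prod_type' (f := fun a b => if a < b then g a b else 0),
    ← Finset.sum_filter,
    ← Finset.sum_subtype (p := fun p : Fin n × Fin n => p.1 < p.2)
      (Finset.univ.filter fun p : Fin n × Fin n => p.1 < p.2) (by simp) (fun p => g p.1 p.2)]

/-- The signs agree: removing the smaller index of a pair gives `+`, removing the larger gives `-`.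
-/
theorem koszulD_eq_koszul (f : MvPolynomial (Fin n) ℂ) (u : Finset (Fin n) → O n) (k : Fin n) :
    koszulD f (fun p => u {p.1.1, p.1.2}) k = koszul (partialD f) u {k} := by
  rw [koszulD_apply, koszul_eq, Finset.sum_apply,
    sum_pairs fun a b => u {a, b} * ((if k = b then partialD f a else 0) -
        (if k = a then partialD f b else 0))]
  have h1 : ∀ a b : Fin n, (if a < b then u {a, b} * ((if k = b then partialD f a else 0) -
        (if k = a then partialD f b else 0)) else 0) =
      (if k = b then (if a < b then u {a, b} * partialD f a else 0) else 0) -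
      (if k = a then (if a < b then u {a, b} * partialD f b else 0) else 0) := by
    intro a b
    split_ifs <;> ring
  simp only [h1, Finset.sum_sub_distrib, Finset.sum_ite_eq, Finset.mem_univ, if_true]
  rw [Finset.sum_comm (f := fun a b => if k = a then
    (if a < b then u {a, b} * partialD f b else 0) else 0)]
  simp only [Finset.sum_ite_eq, Finset.mem_univ, if_true, ← Finset.sum_sub_distrib]
  refine Finset.sum_congr rfl fun j _ => ?_
  rw [Pi.smul_apply, contract_apply, smul_eq_mul]
  unfold wedgeSign
  rcases lt_trichotomy j k with h | h | h
  · simp [h, h.ne, h.not_gt, Finset.filter_singleton, mul_comm]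
  · simp [h]
  · simp [h, h.ne', h.not_gt, Finset.filter_singleton, mul_comm, Finset.pair_comm]

theorem sum_koszulD_mul_partialD (f : MvPolynomial (Fin n) ℂ) (v : Pairs n → O n) :
    ∑ k, koszulD f v k * partialD f k = 0 := by
  simp only [koszulD_apply, Finset.sum_mul]
  rw [Finset.sum_comm]
  refine Finset.sum_eq_zero fun p _ => ?_
  simp only [mul_assoc, ← Finset.mul_sum, sub_mul, ite_mul, zero_mul, Finset.sum_sub_distrib,
    Finset.sum_ite_eq', Finset.mem_univ, if_true]
  ring

/-- The quantitative input of the whole argument: the loss `n * N` does not depend on `q`, which is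
what bounds the gap numbers. -/
theorem exists_koszulD_eq (f : MvPolynomial (Fin n) ℂ) (N : ℕ)
    (hN : ∀ i, (MvPowerSeries.X i ^ N : O n) ∈ jacobiIdeal f) {q : ℕ} {z : Fin n → O n}
    (hq : ∀ i, z i ∈ maxIdeal n ^ q) (h0 : ∑ i, z i * partialD f i = 0) :
    ∃ v : Pairs n → O n, (∀ p, v p ∈ maxIdeal n ^ (q - n * N)) ∧ koszulD f v = z := by
  have hN' : ∀ i, ∃ c : Fin n → O n, ∑ j, c j * partialD f j = MvPowerSeries.X i ^ N := fun i =>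
    Ideal.mem_span_range_iff_exists_fun.1 (hN i)
  choose c hc using hN'
  -- The 1-chain as an element of the exterior algebra; on a singleton the sum just reads off its
  -- one entry.
  set Z : Finset (Fin n) → O n := fun S => if S.card = 1 then ∑ i ∈ S, z i else 0 with hZ
  have hZ1 : ∀ i, Z {i} = z i := fun i => by simp [hZ]
  have hZ2 : ∀ S, Z S ≠ 0 → S.card = 1 := fun S hS => by
    by_contra h
    exact hS (if_neg h)
  obtain ⟨u, hu, hu'⟩ := exists_koszul_eq (partialD f) N c hc one_pos hZ2 (q := q)
    (fun S => by
      by_cases h : S.card = 1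
      · obtain ⟨i, rfl⟩ := Finset.card_eq_one.1 h
        rw [hZ1]; exact hq i
      · rw [hZ]; simp only [if_neg h]; exact zero_mem _)
    (by
      ext1 S
      rw [koszul_eq, Finset.sum_apply, Pi.zero_apply]
      rcases S.eq_empty_or_nonempty with rfl | hS
      · rw [← h0]
        refine Finset.sum_congr rfl fun j _ => ?_
        simp [contract_apply, wedgeSign, hZ1, mul_comm]
      · refine Finset.sum_eq_zero fun j _ => ?_
        rw [Pi.smul_apply, contract_apply]
        split_ifs with h
        · exact smul_zero _
        · have : Z (insert j S) = 0 := by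
            by_contra h'
            have h1 := hZ2 _ h'
            rw [Finset.card_insert_of_notMem h] at h1
            have := hS.card_pos
            omega
          rw [this, mul_zero, smul_zero])
  refine ⟨fun p => u {p.1.1, p.1.2}, fun p => hu _, ?_⟩
  ext1 k
  rw [koszulD_eq_koszul, hu', hZ1]

end

/-! ### Consequences of weighted homogeneity: the Jacobi ideal contains a power of the maximal
ideal. -/

section

variable {n : ℕ}

theorem boxIdeal_le {I : Ideal (O n)} {N : ℕ} (hN : ∀ i, (MvPowerSeries.X i ^ N : O n) ∈ I) :
    ∀ d ≤ n, boxIdeal n d N ≤ I := by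
  intro d
  induction d with
  | zero => intro _; rw [boxIdeal_zero]; exact bot_le
  | succ d ih =>
    intro hd g hg
    obtain ⟨v, r, hgr, -, hr⟩ := exists_eq_X_pow_mul_add_of_mem_boxIdeal ⟨d, hd⟩ N 0 hg (by simp)
    rw [hgr]
    exact add_mem (I.mul_mem_right _ (hN _)) (ih (Nat.le_of_succ_le hd) hr)

/-- Pigeonhole: a monomial of degree above `n * N` has some exponent at least `N`. -/
theorem maxIdeal_pow_le_of_X_pow_mem {I : Ideal (O n)} {N : ℕ}
    (hN : ∀ i, (MvPowerSeries.X i ^ N : O n) ∈ I) : maxIdeal n ^ (n * N + 1) ≤ I := by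
  refine le_trans (b := boxIdeal n n N) (fun g hg e he => ?_) (boxIdeal_le hN n le_rfl)
  by_contra! h
  refine he (mem_maxIdeal_pow.1 hg e (Nat.lt_succ_of_le ?_))
  rw [Finsupp.degree_eq_sum]
  calc ∑ i, e i ≤ ∑ _i : Fin n, N := Finset.sum_le_sum fun i _ => (h i i.2).le
    _ = n * N := by simp

section WeightedHomogeneous

variable {w : Fin n → ℚ} {W : ℚ} {f : MvPolynomial (Fin n) ℂ}

/-- Euler's identity for rational weights. -/
theorem sum_weight_mul_X_mul_pderiv (hf : MvPolynomial.IsWeightedHomogeneous w f W) :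
    ∑ i, (w i : ℂ) • (MvPolynomial.X i * MvPolynomial.pderiv i f) = (W : ℂ) • f := by
  have h : ∀ i, MvPolynomial.X i * MvPolynomial.pderiv i f =
      ∑ e ∈ f.support, (e i : ℂ) • MvPolynomial.monomial e (f.coeff e) := by
    intro i
    conv_lhs => rw [f.as_sum, map_sum, Finset.mul_sum]
    refine Finset.sum_congr rfl fun e _ => ?_
    rw [MvPolynomial.X_mul_pderiv_monomial, Nat.cast_smul_eq_nsmul]
  simp only [h, Finset.smul_sum]
  rw [Finset.sum_comm]
  conv_rhs => rw [f.as_sum, Finset.smul_sum]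
  refine Finset.sum_congr rfl fun e he => ?_
  have h1 := hf (MvPolynomial.mem_support_iff.1 he)
  rw [Finsupp.weight_apply, Finsupp.sum_fintype _ _ (by simp)] at h1
  simp only [smul_smul, ← Finset.sum_smul]
  congr 1
  rw [← h1]
  push_cast
  exact Finset.sum_congr rfl fun i _ => by rw [nsmul_eq_mul, mul_comm]; push_cast; rfl

/-- Homogeneity along a real one-parameter group; the exponential avoids choosing roots for rational
weights. -/
theorem eval_exp_mul (hf : MvPolynomial.IsWeightedHomogeneous w f W) (s : ℝ) (x : Fin n → ℂ) :
    MvPolynomial.eval (fun i => (Real.exp (s * w i) : ℂ) * x i) f =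
      (Real.exp (s * W) : ℂ) * MvPolynomial.eval x f := by
  rw [MvPolynomial.eval_eq', MvPolynomial.eval_eq', Finset.mul_sum]
  refine Finset.sum_congr rfl fun e he => ?_
  have h1 := hf (MvPolynomial.mem_support_iff.1 he)
  rw [Finsupp.weight_apply, Finsupp.sum_fintype _ _ (by simp)] at h1
  have h2 : ∏ i, (Real.exp (s * w i) : ℂ) ^ e i = (Real.exp (s * W) : ℂ) := by
    have : ∏ i, Real.exp (s * w i) ^ e i = Real.exp (s * W) := by
      rw [← h1]
      push_cast
      rw [Finset.mul_sum, Real.exp_sum]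
      refine Finset.prod_congr rfl fun i _ => ?_
      rw [← Real.exp_nat_mul]
      congr 1
      push_cast [nsmul_eq_mul]
      ring
    exact_mod_cast this
  simp only [mul_pow, Finset.prod_mul_distrib, h2]
  ring

theorem ne_zero_of_hasIsolatedSingularity (hn : 1 ≤ n) (hsing : HasIsolatedSingularity f) :
    f ≠ 0 := by
  rintro rfl
  have : Nonempty (Fin n) := ⟨⟨0, hn⟩⟩
  have : (𝓝[≠] (0 : Fin n → ℂ)).NeBot := inferInstance
  obtain ⟨x, hx⟩ := hsing.2.exists
  exact hx ⟨by simp, by simp⟩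

/-- Since `f ≠ 0` and `f(0) = 0`, some nonconstant monomial occurs, and its weight is positive. -/
theorem weight_pos (hn : 1 ≤ n) (hw : ∀ i, 0 < w i)
    (hf : MvPolynomial.IsWeightedHomogeneous w f W) (hsing : HasIsolatedSingularity f) :
    0 < W := by
  obtain ⟨e, he⟩ := MvPolynomial.ne_zero_iff.1 (ne_zero_of_hasIsolatedSingularity hn hsing)
  have h1 := hf he
  rw [Finsupp.weight_apply, Finsupp.sum_fintype _ _ (by simp)] at h1
  have he0 : e ≠ 0 := by
    rintro rfl
    apply he
    have := hsing.1.1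
    rwa [MvPolynomial.eval_zero, MvPolynomial.constantCoeff_eq] at this
  obtain ⟨i, hi⟩ := Finsupp.ne_iff.1 he0
  rw [← h1]
  refine Finset.sum_pos' (fun j _ => nsmul_nonneg (hw j).le _) ⟨i, Finset.mem_univ _, ?_⟩
  exact nsmul_pos (hw i) hi

/-- Euler's identity makes every critical point `x` a singular point of `V(f)`. Its orbit under
weighted scaling consists of singular points and tends to the origin as `s → -∞`, which contradicts
isolation unless `x = 0`. -/
theorem eq_zero_of_eval_pderiv_eq_zero (hw : ∀ i, 0 < w i) (hW : 0 < W)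
    (hf : MvPolynomial.IsWeightedHomogeneous w f W) (hsing : HasIsolatedSingularity f)
    {x : Fin n → ℂ} (hx : ∀ i, MvPolynomial.eval x (MvPolynomial.pderiv i f) = 0) : x = 0 := by
  by_contra hx0
  have hfx : MvPolynomial.eval x f = 0 := by
    have h := congrArg (MvPolynomial.eval x) (sum_weight_mul_X_mul_pderiv hf)
    simp only [map_sum, MvPolynomial.smul_eval, map_mul, hx, mul_zero, Finset.sum_const_zero] at h
    have hW' : (W : ℂ) ≠ 0 := by exact_mod_cast hW.ne'
    exact (mul_eq_zero.1 h.symm).resolve_left hW'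
  set y : ℝ → Fin n → ℂ := fun s i => (Real.exp (s * w i) : ℂ) * x i with hy
  have hsingy : ∀ s, IsSingularPoint f (y s) := fun s =>
    ⟨by rw [hy, eval_exp_mul hf, hfx, mul_zero], fun i => by
      -- The `i`-th partial derivative is weighted homogeneous of weight `W - w i`.
      rw [hy, eval_exp_mul (hf.pderiv (sub_add_cancel W (w i))), hx, mul_zero]⟩
  have hlim : Filter.Tendsto y Filter.atBot (𝓝[≠] 0) := by
    refine tendsto_nhdsWithin_iff.2 ⟨tendsto_pi_nhds.2 fun i => ?_,
      Filter.Eventually.of_forall fun s h => hx0 ?_⟩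
    · have h1 : Filter.Tendsto (fun s : ℝ => Real.exp (s * w i)) Filter.atBot (𝓝 0) :=
        Real.tendsto_exp_atBot.comp
          (Filter.tendsto_id.atBot_mul_const (by exact_mod_cast hw i))
      have h2 := (Complex.continuous_ofReal.tendsto 0).comp h1
      have h3 := h2.mul_const (x i)
      simpa [hy] using h3
    · ext1 i
      have := congrFun h i
      simpa [hy] using this
  obtain ⟨s, hs⟩ := (hlim.eventually hsing.2).exists
  exact hs (hsingy s)

/-- Each coordinate vanishes on the common zero set of the partial derivatives, so by the
Nullstellensatz it lies in the radical of their ideal; this passes to power series. -/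
theorem exists_X_pow_mem_jacobiIdeal (hw : ∀ i, 0 < w i) (hW : 0 < W)
    (hf : MvPolynomial.IsWeightedHomogeneous w f W) (hsing : HasIsolatedSingularity f) :
    ∃ N, ∀ i, (MvPowerSeries.X i ^ N : O n) ∈ jacobiIdeal f := by
  set I : Ideal (MvPolynomial (Fin n) ℂ) :=
    Ideal.span (Set.range fun i => MvPolynomial.pderiv i f) with hI
  have hX : ∀ i, ∃ N, (MvPolynomial.X i : MvPolynomial (Fin n) ℂ) ^ N ∈ I := by
    intro i
    have : (MvPolynomial.X i : MvPolynomial (Fin n) ℂ) ∈ I.radical := by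
      rw [← MvPolynomial.vanishingIdeal_zeroLocus_eq_radical (K := ℂ) I]
      intro x hx
      have : x = 0 := eq_zero_of_eval_pderiv_eq_zero hw hW hf hsing fun j => by
        rw [← MvPolynomial.aeval_eq_eval]
        exact hx _ (Ideal.subset_span ⟨j, rfl⟩)
      simp [this]
    exact this
  choose N hN using hX
  have hmap : I.map MvPolynomial.coeToMvPowerSeries.ringHom = jacobiIdeal f := by
    rw [hI, Ideal.map_span, ← Set.range_comp]
    rfl
  -- The sum is an exponent that serves all variables at once.
  refine ⟨∑ i, N i, fun i => ?_⟩
  have h1 : (MvPowerSeries.X i ^ N i : O n) ∈ jacobiIdeal f := by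
    have := Ideal.mem_map_of_mem MvPolynomial.coeToMvPowerSeries.ringHom (hN i)
    rw [hmap, map_pow] at this
    simpa using this
  exact Ideal.pow_mem_of_pow_mem _ h1 (Finset.single_le_sum (fun _ _ => Nat.zero_le _)
    (Finset.mem_univ i))

theorem mem_maxIdeal_mul_jacobiIdeal (hW : 0 < W)
    (hf : MvPolynomial.IsWeightedHomogeneous w f W) :
    (f : MvPowerSeries (Fin n) ℂ) ∈ maxIdeal n * jacobiIdeal f := by
  have hW' : (W : ℂ) ≠ 0 := by exact_mod_cast hW.ne'
  have h := congrArg MvPolynomial.coeToMvPowerSeries.ringHom (sum_weight_mul_X_mul_pderiv hf)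
  have h1 : (W : ℂ) • (f : MvPowerSeries (Fin n) ℂ) ∈ maxIdeal n * jacobiIdeal f := by
    simp only [map_sum, MvPolynomial.smul_eq_C_mul, map_mul,
      MvPolynomial.coeToMvPowerSeries.ringHom_apply, MvPolynomial.coe_C, MvPolynomial.coe_X] at h
    rw [MvPowerSeries.smul_eq_C_mul, ← h]
    exact sum_mem fun i _ => Ideal.mul_mem_left _ _
      (Ideal.mul_mem_mul (X_mem_maxIdeal i) (Ideal.subset_span ⟨i, rfl⟩))
  have h2 : (f : MvPowerSeries (Fin n) ℂ) =
      MvPowerSeries.C (W : ℂ)⁻¹ * ((W : ℂ) • (f : MvPowerSeries (Fin n) ℂ)) := by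
    rw [← MvPowerSeries.smul_eq_C_mul, smul_smul, inv_mul_cancel₀ hW', one_smul]
  rw [h2]
  exact Ideal.mul_mem_left _ _ h1

end WeightedHomogeneous

end

/-! ### Dimensions of subquotients. -/

section

variable {n : ℕ}

section RelDim

variable (K : Type*) {R V V' X : Type*} [Field K] [CommRing R] [Algebra K R]
  [AddCommGroup V] [Module R V] [Module K V] [IsScalarTower K R V]
  [AddCommGroup V'] [Module R V'] [Module K V'] [IsScalarTower K R V']
  [AddCommGroup X] [Module K X]

/-- The dimension of `B / A` for submodules `A ≤ B`. -/
def relDim (A B : Submodule R V) : ℕ := Module.finrank K (B ⧸ A.submoduleOf B)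

/-- `B / A` has finite dimension. -/
def RelFinite (A B : Submodule R V) : Prop := Module.Finite K (B ⧸ A.submoduleOf B)

variable {K}

/-- The first isomorphism theorem for scalars restricted to `K`. -/
def quotientEquivOfSurjective {A B : Submodule R V} (f : B →ₗ[K] X)
    (hf : Function.Surjective f) (h : ∀ x, f x = 0 ↔ (x : V) ∈ A) :
    (B ⧸ A.submoduleOf B) ≃ₗ[K] X :=
  (Submodule.Quotient.restrictScalarsEquiv K (A.submoduleOf B)).symm.trans
    ((Submodule.quotEquivOfEq _ (LinearMap.ker f) (by
      ext x
      rw [Submodule.restrictScalars_mem, LinearMap.mem_ker, h]; rfl)).trans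
      (f.quotKerEquivOfSurjective hf))

theorem finrank_eq_relDim {A B : Submodule R V} (f : B →ₗ[K] X)
    (hf : Function.Surjective f) (h : ∀ x, f x = 0 ↔ (x : V) ∈ A) :
    relDim K A B = Module.finrank K X :=
  (quotientEquivOfSurjective f hf h).finrank_eq

theorem finite_iff_relFinite {A B : Submodule R V} (f : B →ₗ[K] X)
    (hf : Function.Surjective f) (h : ∀ x, f x = 0 ↔ (x : V) ∈ A) :
    RelFinite K A B ↔ Module.Finite K X :=
  Module.Finite.equiv_iff (quotientEquivOfSurjective f hf h)

theorem relDim_eq_finrank_quotient (A : Submodule R V) :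
    relDim K A ⊤ = Module.finrank K (V ⧸ A) :=
  finrank_eq_relDim ((A.mkQ ∘ₗ (⊤ : Submodule R V).subtype).restrictScalars K)
    (fun x => by
      obtain ⟨y, rfl⟩ := A.mkQ_surjective x
      exact ⟨⟨y, trivial⟩, rfl⟩)
    (fun x => Submodule.Quotient.mk_eq_zero A)

theorem relFinite_top_iff (A : Submodule R V) :
    RelFinite K A ⊤ ↔ Module.Finite K (V ⧸ A) :=
  finite_iff_relFinite ((A.mkQ ∘ₗ (⊤ : Submodule R V).subtype).restrictScalars K)
    (fun x => by
      obtain ⟨y, rfl⟩ := A.mkQ_surjective x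
      exact ⟨⟨y, trivial⟩, rfl⟩)
    (fun x => Submodule.Quotient.mk_eq_zero A)

theorem relDim_self (A : Submodule R V) : relDim K A A = 0 := by
  rw [finrank_eq_relDim (X := PUnit) (0 : A →ₗ[K] PUnit) (fun x => ⟨0, rfl⟩)
    (fun x => ⟨fun _ => x.2, fun _ => rfl⟩)]
  exact Module.finrank_zero_of_subsingleton

section Chain

variable {A B C : Submodule R V}

/-- The projection `C / A → C / B`. -/
def relFactor (hAB : A ≤ B) (C : Submodule R V) :
    (C ⧸ A.submoduleOf C) →ₗ[K] (C ⧸ B.submoduleOf C) :=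
  (Submodule.factor (p := A.submoduleOf C) (p' := B.submoduleOf C)
    (fun _ h => hAB h)).restrictScalars K

theorem relFactor_surjective (hAB : A ≤ B) : Function.Surjective (relFactor (K := K) hAB C) := by
  intro x
  obtain ⟨y, rfl⟩ := Submodule.mkQ_surjective _ x
  exact ⟨Submodule.Quotient.mk y, rfl⟩

/-- The map from `B` to the kernel of `C / A → C / B`. -/
def toKerRelFactor (hAB : A ≤ B) (hBC : B ≤ C) :
    B →ₗ[K] LinearMap.ker (relFactor (K := K) hAB C) :=
  LinearMap.codRestrict _
    (((A.submoduleOf C).mkQ ∘ₗ Submodule.inclusion hBC).restrictScalars K) (fun x => by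
      rw [LinearMap.mem_ker]
      exact (Submodule.Quotient.mk_eq_zero (B.submoduleOf C)).2 x.2)

theorem toKerRelFactor_surjective (hAB : A ≤ B) (hBC : B ≤ C) :
    Function.Surjective (toKerRelFactor (K := K) hAB hBC) := by
  rintro ⟨x, hx⟩
  obtain ⟨y, rfl⟩ := Submodule.mkQ_surjective _ x
  have : (y : V) ∈ B := (Submodule.Quotient.mk_eq_zero (B.submoduleOf C)).1 (LinearMap.mem_ker.1 hx)
  exact ⟨⟨y, this⟩, rfl⟩

theorem toKerRelFactor_eq_zero_iff (hAB : A ≤ B) (hBC : B ≤ C) (x : B) :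
    toKerRelFactor (K := K) hAB hBC x = 0 ↔ (x : V) ∈ A := by
  rw [← Subtype.coe_inj]
  exact Submodule.Quotient.mk_eq_zero (A.submoduleOf C)

theorem RelFinite.left (hAB : A ≤ B) (hBC : B ≤ C) (h : RelFinite K A C) : RelFinite K A B := by
  have : Module.Finite K (C ⧸ A.submoduleOf C) := h
  rw [finite_iff_relFinite _ (toKerRelFactor_surjective hAB hBC)
    (toKerRelFactor_eq_zero_iff hAB hBC)]
  infer_instance

theorem RelFinite.right (hAB : A ≤ B) (h : RelFinite K A C) : RelFinite K B C := by
  have : Module.Finite K (C ⧸ A.submoduleOf C) := h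
  exact Module.Finite.of_surjective _ (relFactor_surjective (K := K) (C := C) hAB)

/-- Rank–nullity for `C / A → C / B`. Finiteness is essential, because `finrank` is zero on
infinite-dimensional spaces. -/
theorem relDim_add (hAB : A ≤ B) (hBC : B ≤ C) (h : RelFinite K A C) :
    relDim K A C = relDim K A B + relDim K B C := by
  have : Module.Finite K (C ⧸ A.submoduleOf C) := h
  rw [finrank_eq_relDim _ (toKerRelFactor_surjective hAB hBC)
    (toKerRelFactor_eq_zero_iff hAB hBC), add_comm]
  have h1 := (relFactor (K := K) hAB C).finrank_range_add_finrank_ker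
  rw [LinearMap.range_eq_top.2 (relFactor_surjective hAB), finrank_top] at h1
  exact h1.symm

end Chain

section Map

variable {A B : Submodule R V}

/-- The map `S → d(S) ⊔ A / A`. -/
def mapToQuotient (d : V →ₗ[R] V') (A : Submodule R V') (S : Submodule R V) :
    S →ₗ[K] ((A ⊔ S.map d : Submodule R V') ⧸ A.submoduleOf (A ⊔ S.map d)) :=
  ((A.submoduleOf (A ⊔ S.map d)).mkQ ∘ₗ
    LinearMap.codRestrict (A ⊔ S.map d) (d ∘ₗ S.subtype)
      (fun x => (le_sup_right : S.map d ≤ _) ⟨x, x.2, rfl⟩)).restrictScalars K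

theorem mapToQuotient_eq_zero_iff (d : V →ₗ[R] V') (A : Submodule R V') (S : Submodule R V)
    (x : S) : mapToQuotient (K := K) d A S x = 0 ↔ (x : V) ∈ A.comap d ⊓ S := by
  refine (Submodule.Quotient.mk_eq_zero (A.submoduleOf (A ⊔ S.map d))).trans ?_
  exact ⟨fun h => ⟨h, x.2⟩, fun h => h.1⟩

theorem mapToQuotient_surjective (d : V →ₗ[R] V') (A : Submodule R V') (S : Submodule R V) :
    Function.Surjective (mapToQuotient (K := K) d A S) := by
  intro x
  obtain ⟨⟨y, hy⟩, rfl⟩ := Submodule.mkQ_surjective _ x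
  obtain ⟨a, ha, b, ⟨c, hc, rfl⟩, rfl⟩ := Submodule.mem_sup.1 hy
  refine ⟨⟨c, hc⟩, ?_⟩
  refine (Submodule.Quotient.eq _).2 ?_
  change d c - (a + d c) ∈ A
  rw [sub_add_cancel_right]
  exact neg_mem ha

/-- The second isomorphism theorem for a linear map. -/
theorem relDim_comap_inf (d : V →ₗ[R] V') (A : Submodule R V') (S : Submodule R V) :
    relDim K (A.comap d ⊓ S) S = relDim K A (A ⊔ S.map d) :=
  finrank_eq_relDim _ (mapToQuotient_surjective d A S) (mapToQuotient_eq_zero_iff d A S)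

theorem relFinite_comap_inf (d : V →ₗ[R] V') (A : Submodule R V') (S : Submodule R V) :
    RelFinite K (A.comap d ⊓ S) S ↔ RelFinite K A (A ⊔ S.map d) :=
  finite_iff_relFinite _ (mapToQuotient_surjective d A S) (mapToQuotient_eq_zero_iff d A S)

theorem relDim_inf (A B : Submodule R V) : relDim K (A ⊓ B) B = relDim K A (A ⊔ B) := by
  simpa using relDim_comap_inf (K := K) LinearMap.id A B

theorem relFinite_inf (A B : Submodule R V) :
    RelFinite K (A ⊓ B) B ↔ RelFinite K A (A ⊔ B) := by
  simpa using relFinite_comap_inf (K := K) LinearMap.id A B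

end Map

section Image

variable {A A' B : Submodule R V}

/-- The map from `A` onto its image in `B / C`. -/
def toImage (hA : A ≤ B) (C : Submodule R V) :
    A →ₗ[R] ((A.submoduleOf B).map (C.submoduleOf B).mkQ : Submodule R (B ⧸ C.submoduleOf B)) :=
  LinearMap.codRestrict _ ((C.submoduleOf B).mkQ ∘ₗ Submodule.inclusion hA)
    (fun x => ⟨⟨x, hA x.2⟩, x.2, rfl⟩)

theorem toImage_surjective (hA : A ≤ B) (C : Submodule R V) :
    Function.Surjective (toImage hA C) := by
  rintro ⟨_, ⟨x, hx, rfl⟩⟩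
  exact ⟨⟨x, hx⟩, rfl⟩

theorem finrank_map_mkQ (hA : A ≤ B) (C : Submodule R V) :
    Module.finrank K ((A.submoduleOf B).map (C.submoduleOf B).mkQ :
        Submodule R (B ⧸ C.submoduleOf B)) = relDim K (C ⊓ A) A := by
  refine (finrank_eq_relDim ((toImage hA C).restrictScalars K) (toImage_surjective hA C)
    fun x => ?_).symm
  rw [← Subtype.coe_inj]
  refine (Submodule.Quotient.mk_eq_zero (C.submoduleOf B)).trans ?_
  exact ⟨fun h => ⟨h, x.2⟩, fun h => h.1⟩

/-- The image of `A` in `B / C` modulo the image of `A'` is `A` modulo `A' ⊔ (C ⊓ A)`. -/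
def mapMkQQuotientEquiv (hA' : A' ≤ A) (hA : A ≤ B) (C : Submodule R V) :
    (A ⧸ (A' ⊔ (C ⊓ A)).submoduleOf A) ≃ₗ[K]
      (((A.submoduleOf B).map (C.submoduleOf B).mkQ : Submodule R (B ⧸ C.submoduleOf B)) ⧸
      ((A'.submoduleOf B).map (C.submoduleOf B).mkQ).submoduleOf
        ((A.submoduleOf B).map (C.submoduleOf B).mkQ)) :=
  quotientEquivOfSurjective
    ((Submodule.mkQ _ ∘ₗ toImage hA C).restrictScalars K)
    (by
      intro x
      obtain ⟨y, rfl⟩ := Submodule.mkQ_surjective _ x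
      obtain ⟨z, rfl⟩ := toImage_surjective hA C y
      exact ⟨z, rfl⟩)
    (by
      intro x
      refine (Submodule.Quotient.mk_eq_zero _).trans ?_
      constructor
      · rintro ⟨y, hy, hxy⟩
        have h1 : (y : V) - x ∈ C := (Submodule.Quotient.eq (C.submoduleOf B)).1 hxy
        have h2 : (x : V) = y + (x - y) := by abel
        rw [h2]
        refine Submodule.add_mem_sup hy ⟨?_, sub_mem x.2 (hA' hy)⟩
        rw [← neg_sub]
        exact neg_mem h1
      · intro hx
        obtain ⟨y, hy, c, hc, hxy⟩ := Submodule.mem_sup.1 hx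
        refine ⟨⟨y, hA (hA' hy)⟩, hy, (Submodule.Quotient.eq (C.submoduleOf B)).2 ?_⟩
        change y - (x : V) ∈ C
        rw [← hxy, sub_add_cancel_left]
        exact neg_mem hc.1)

end Image

end RelDim

end

/-! ### Dimensions of the graded pieces, by counting monomials. -/

section

variable {n : ℕ}

/-- The coefficients of a power series at the exponents in a finite set. -/
def coeffMap (T : Finset (Fin n →₀ ℕ)) : O n →ₗ[ℂ] (T → ℂ) :=
  LinearMap.pi fun e => MvPowerSeries.coeff (e : Fin n →₀ ℕ)

theorem coeffMap_apply (T : Finset (Fin n →₀ ℕ)) (g : O n) (e : T) :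
    coeffMap T g e = MvPowerSeries.coeff (e : Fin n →₀ ℕ) g := rfl

section Degrees

variable {a b : ℕ} {T : Finset (Fin n →₀ ℕ)}

theorem exists_mem_coeffMap_eq (hT : ∀ e, e ∈ T ↔ a ≤ e.degree ∧ e.degree < b) (y : T → ℂ) :
    ∃ g ∈ maxIdeal n ^ a, coeffMap T g = y := by
  obtain ⟨g, hg⟩ : ∃ g : O n, ∀ e, MvPowerSeries.coeff e g =
      if h : e ∈ T then y ⟨e, h⟩ else 0 := ⟨fun e => _, fun e => rfl⟩
  refine ⟨g, ?_, ?_⟩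
  · rw [mem_maxIdeal_pow]
    intro e he
    rw [hg, dif_neg]
    intro h
    exact absurd ((hT e).1 h).1 (not_le.2 he)
  · ext e
    rw [coeffMap_apply, hg, dif_pos e.2]

theorem coeffMap_eq_zero_iff (hT : ∀ e, e ∈ T ↔ a ≤ e.degree ∧ e.degree < b) {g : O n}
    (hg : g ∈ maxIdeal n ^ a) : coeffMap T g = 0 ↔ g ∈ maxIdeal n ^ b := by
  rw [mem_maxIdeal_pow] at hg ⊢
  constructor
  · intro h e he
    by_cases h1 : a ≤ e.degree
    · exact congrFun h ⟨e, (hT e).2 ⟨h1, he⟩⟩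
    · exact hg e (not_le.1 h1)
  · intro h
    ext e
    exact h e ((hT e).1 e.2).2

end Degrees

section Pi

variable {ι : Type*} {a b : ι → ℕ} {T : ι → Finset (Fin n →₀ ℕ)}

/-- Componentwise coefficients of a vector of power series. -/
def piCoeffMap (T : ι → Finset (Fin n →₀ ℕ)) (S : Submodule (O n) (ι → O n)) :
    S →ₗ[ℂ] (∀ i, T i → ℂ) :=
  LinearMap.pi (fun i => coeffMap (T i) ∘ₗ LinearMap.proj i) ∘ₗ S.subtype.restrictScalars ℂ

theorem piCoeffMap_surjective (hT : ∀ i e, e ∈ T i ↔ a i ≤ e.degree ∧ e.degree < b i) :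
    Function.Surjective
      (piCoeffMap T (Submodule.pi Set.univ fun i => (maxIdeal n ^ a i : Ideal (O n)))) := by
  intro y
  choose g hg hg' using fun i => exists_mem_coeffMap_eq (hT i) (y i)
  exact ⟨⟨g, fun i _ => hg i⟩, funext hg'⟩

theorem piCoeffMap_eq_zero_iff (hT : ∀ i e, e ∈ T i ↔ a i ≤ e.degree ∧ e.degree < b i)
    (x : (Submodule.pi Set.univ fun i => (maxIdeal n ^ a i : Ideal (O n)) :
      Submodule (O n) (ι → O n))) :
    piCoeffMap T _ x = 0 ↔ (x : ι → O n) ∈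
      (Submodule.pi Set.univ fun i => (maxIdeal n ^ b i : Ideal (O n)) :
        Submodule (O n) (ι → O n)) := by
  rw [funext_iff]
  constructor
  · intro h i _
    exact (coeffMap_eq_zero_iff (hT i) (x.2 i trivial)).1 (h i)
  · intro h i
    exact (coeffMap_eq_zero_iff (hT i) (x.2 i trivial)).2 (h i trivial)

theorem relDim_pi_maxIdeal_pow [Fintype ι]
    (hT : ∀ i e, e ∈ T i ↔ a i ≤ e.degree ∧ e.degree < b i) :
    relDim ℂ (Submodule.pi Set.univ fun i => (maxIdeal n ^ b i : Ideal (O n)) :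
        Submodule (O n) (ι → O n))
      (Submodule.pi Set.univ fun i => (maxIdeal n ^ a i : Ideal (O n))) = ∑ i, (T i).card := by
  rw [finrank_eq_relDim _ (piCoeffMap_surjective hT) (piCoeffMap_eq_zero_iff hT),
    Module.finrank_pi_fintype]
  simp

theorem relFinite_pi_maxIdeal_pow [Finite ι]
    (hT : ∀ i e, e ∈ T i ↔ a i ≤ e.degree ∧ e.degree < b i) :
    RelFinite ℂ (Submodule.pi Set.univ fun i => (maxIdeal n ^ b i : Ideal (O n)) :
        Submodule (O n) (ι → O n))
      (Submodule.pi Set.univ fun i => (maxIdeal n ^ a i : Ideal (O n))) := by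
  rw [finite_iff_relFinite _ (piCoeffMap_surjective hT) (piCoeffMap_eq_zero_iff hT)]
  infer_instance

end Pi

/-- The exponents of total degree `k`. -/
def exponents (n k : ℕ) : Finset (Fin n →₀ ℕ) := Finset.finsuppAntidiag Finset.univ k

theorem mem_exponents {k : ℕ} {e : Fin n →₀ ℕ} : e ∈ exponents n k ↔ e.degree = k := by
  simp [exponents, Finset.mem_finsuppAntidiag, Finsupp.degree_eq_sum]

theorem mem_exponents_iff {k : ℕ} {e : Fin n →₀ ℕ} :
    e ∈ exponents n k ↔ k ≤ e.degree ∧ e.degree < k + 1 := by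
  rw [mem_exponents]; omega

/-- The Hilbert series of the ring of power series. -/
def hilbertSeries (n : ℕ) : PowerSeries ℚ :=
  PowerSeries.mk fun k => ((exponents n k).card : ℚ)

/-- There are `(n-1+k).choose (n-1)` monomials of degree `k`; this form of the count requires `n ≥
1`. -/
theorem hilbertSeries_mul (hn : 1 ≤ n) : hilbertSeries n * (1 - PowerSeries.X) ^ n = 1 := by
  obtain ⟨d, rfl⟩ : ∃ d, n = d + 1 := ⟨n - 1, by omega⟩
  refine Eq.trans ?_ (PowerSeries.mk_add_choose_mul_one_sub_pow_eq_one ℚ d)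
  congr 1
  ext k
  rw [hilbertSeries, PowerSeries.coeff_mk, PowerSeries.coeff_mk, exponents,
    Finset.card_finsuppAntidiag_nat_eq_choose, Finset.card_univ, Fintype.card_fin,
    Nat.add_right_comm, Nat.add_sub_cancel, Nat.choose_symm_add]

theorem relDim_maxIdeal_pow_succ (k : ℕ) :
    relDim ℂ (maxIdeal n ^ (k + 1)) (maxIdeal n ^ k) = (exponents n k).card := by
  rw [finrank_eq_relDim (coeffMap (exponents n k) ∘ₗ
    (Submodule.subtype (maxIdeal n ^ k)).restrictScalars ℂ)
    (fun y => by
      obtain ⟨g, hg, hg'⟩ := exists_mem_coeffMap_eq (fun _ => mem_exponents_iff) y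
      exact ⟨⟨g, hg⟩, hg'⟩)
    (fun x => coeffMap_eq_zero_iff (fun _ => mem_exponents_iff) x.2)]
  simp

theorem relFinite_maxIdeal_pow (k : ℕ) :
    RelFinite ℂ (maxIdeal n ^ k) ⊤ := by
  have hT : ∀ e : Fin n →₀ ℕ, e ∈ (Finset.range k).biUnion (exponents n) ↔
      0 ≤ e.degree ∧ e.degree < k := fun e => by simp [mem_exponents]
  rw [← Ideal.one_eq_top, ← pow_zero (maxIdeal n),
    finite_iff_relFinite (coeffMap _ ∘ₗ
    (Submodule.subtype (maxIdeal n ^ 0)).restrictScalars ℂ)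
    (fun y => by
      obtain ⟨g, hg, hg'⟩ := exists_mem_coeffMap_eq hT y
      exact ⟨⟨g, hg⟩, hg'⟩)
    (fun x => coeffMap_eq_zero_iff hT x.2)]
  infer_instance

theorem relDim_filOne (k : ℕ) :
    relDim ℂ (filOne n (k + 1)) (filOne n k) = n * (exponents n k).card := by
  refine (relDim_pi_maxIdeal_pow (T := fun _ => exponents n k)
    (fun _ _ => mem_exponents_iff)).trans ?_
  simp

theorem relFinite_filOne (k : ℕ) : RelFinite ℂ (filOne n (k + 1)) (filOne n k) :=
  relFinite_pi_maxIdeal_pow (T := fun _ => exponents n k) (fun _ _ => mem_exponents_iff)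

/-- With truncated subtraction both bounds are `0` when `d < m`: the basis vector starts only in
degree `m` and contributes nothing below it. -/
theorem mem_exponents_sub_iff (m d : ℕ) (e : Fin n →₀ ℕ) :
    e ∈ (if m ≤ d then exponents n (d - m) else ∅) ↔
      d - m ≤ e.degree ∧ e.degree < d + 1 - m := by
  split_ifs with h
  · rw [mem_exponents]; omega
  · simp; omega

theorem relDim_filTwo (f : MvPolynomial (Fin n) ℂ) (d : ℕ) :
    relDim ℂ (filTwo f (d + 1)) (filTwo f d) =
      ∑ p : Pairs n, if multPair f p ≤ d then (exponents n (d - multPair f p)).card else 0 := by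
  refine (relDim_pi_maxIdeal_pow (T := fun p => if multPair f p ≤ d then
    exponents n (d - multPair f p) else ∅) (fun _ e => mem_exponents_sub_iff _ _ e)).trans ?_
  refine Finset.sum_congr rfl fun p _ => ?_
  split_ifs <;> simp

theorem relFinite_filTwo (f : MvPolynomial (Fin n) ℂ) (d : ℕ) :
    RelFinite ℂ (filTwo f (d + 1)) (filTwo f d) :=
  relFinite_pi_maxIdeal_pow (T := fun p => if multPair f p ≤ d then
    exponents n (d - multPair f p) else ∅) (fun _ e => mem_exponents_sub_iff _ _ e)

end

/-! ### The two filtrations of the 2-chains and their bigraded pieces. -/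

section

variable {n : ℕ}

section Filtration

variable (f : MvPolynomial (Fin n) ℂ)

/-- The 2-chains of filtration degree `p` whose differential has filtration degree `q`. -/
def bifil (p q : ℕ) : Submodule (O n) (Pairs n → O n) :=
  filTwo f p ⊓ (filOne n q).comap (koszulD f)

variable {f}

theorem mem_filTwo {p : ℕ} {x : Pairs n → O n} :
    x ∈ filTwo f p ↔ ∀ i, x i ∈ maxIdeal n ^ (p - multPair f i) := by
  simp [filTwo, Submodule.mem_pi]

theorem mem_filOne {p : ℕ} {x : Fin n → O n} :
    x ∈ filOne n p ↔ ∀ i, x i ∈ maxIdeal n ^ p := by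
  simp [filOne, Submodule.mem_pi]

theorem filTwo_anti {p p' : ℕ} (h : p ≤ p') : filTwo f p' ≤ filTwo f p := fun _ hx =>
  mem_filTwo.2 fun i => Ideal.pow_le_pow_right (Nat.sub_le_sub_right h _) (mem_filTwo.1 hx i)

theorem filOne_anti {p p' : ℕ} (h : p ≤ p') : filOne n p' ≤ filOne n p := fun _ hx =>
  mem_filOne.2 fun i => Ideal.pow_le_pow_right h (mem_filOne.1 hx i)

theorem filTwo_zero : filTwo f 0 = ⊤ := by
  rw [eq_top_iff]
  exact fun x _ => mem_filTwo.2 fun i => by simp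

theorem partialD_mem (i : Fin n) : partialD f i ∈ maxIdeal n ^ mult f i := by
  rw [mem_maxIdeal_pow_iff_le_order]
  exact ENat.natCast_toNat_le_self _

/-- The shift by `m_{i,j}` is chosen for this: both `f_i` and `f_j` have order at least `m_{i,j}`,
so the differential does not lower degree and levels start at `0`. -/
theorem filTwo_le_comap (p : ℕ) : filTwo f p ≤ (filOne n p).comap (koszulD f) := by
  intro x hx
  rw [Submodule.mem_comap, mem_filOne]
  intro k
  rw [koszulD_apply]
  refine sum_mem fun i _ => ?_
  have h1 : ∀ j, multPair f i ≤ mult f j → x i * partialD f j ∈ maxIdeal n ^ p := by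
    intro j hj
    have h2 := Ideal.mul_mem_mul (mem_filTwo.1 hx i) (partialD_mem (f := f) j)
    rw [← pow_add] at h2
    exact Ideal.pow_le_pow_right (by omega) h2
  rw [mul_sub]
  refine sub_mem ?_ ?_
  · split_ifs
    · exact h1 _ (min_le_left _ _)
    · rw [mul_zero]; exact zero_mem _
  · split_ifs
    · exact h1 _ (min_le_right _ _)
    · rw [mul_zero]; exact zero_mem _

theorem bifil_le_filTwo (p q : ℕ) : bifil f p q ≤ filTwo f p := inf_le_left

theorem bifil_anti {p p' q q' : ℕ} (hp : p ≤ p') (hq : q ≤ q') : bifil f p' q' ≤ bifil f p q :=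
  inf_le_inf (filTwo_anti hp) (Submodule.comap_mono (filOne_anti hq))

theorem filTwo_inf_bifil (p q : ℕ) : filTwo f (p + 1) ⊓ bifil f p q = bifil f (p + 1) q := by
  rw [bifil, ← inf_assoc, inf_eq_left.2 (filTwo_anti (Nat.le_succ p)), bifil]

theorem comap_inf_bifil (p q : ℕ) :
    (filOne n (q + 1)).comap (koszulD f) ⊓ bifil f p q = bifil f p (q + 1) := by
  rw [bifil, inf_left_comm, ← Submodule.comap_inf, inf_eq_left.2 (filOne_anti (Nat.le_succ q)),
    bifil]

theorem bifil_inf_bifil (p q : ℕ) :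
    bifil f p (q + 1) ⊓ bifil f (p + 1) q = bifil f (p + 1) (q + 1) := by
  refine le_antisymm (fun x hx => ⟨hx.2.1, hx.1.2⟩) (fun x hx => ⟨?_, ?_⟩)
  · exact bifil_anti (Nat.le_succ p) le_rfl hx
  · exact bifil_anti le_rfl (Nat.le_succ q) hx

theorem bifil_eq_filTwo {p q : ℕ} (h : q ≤ p) : bifil f p q = filTwo f p :=
  inf_eq_left.2 ((filTwo_le_comap p).trans (Submodule.comap_mono (filOne_anti h)))

theorem relFinite_bifil_left (p q : ℕ) : RelFinite ℂ (bifil f (p + 1) q) (bifil f p q) := by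
  rw [← filTwo_inf_bifil, relFinite_inf]
  exact (relFinite_filTwo f p).left le_sup_left
    (sup_le (filTwo_anti (Nat.le_succ p)) inf_le_left)

theorem relFinite_bifil_right (p q : ℕ) : RelFinite ℂ (bifil f p (q + 1)) (bifil f p q) := by
  rw [← comap_inf_bifil, relFinite_comap_inf]
  exact (relFinite_filOne q).left le_sup_left
    (sup_le (filOne_anti (Nat.le_succ q)) (Submodule.map_le_iff_le_comap.2 inf_le_right))

variable (f) in
/-- The dimension of the part of bidegree `(p, q)` of the bigraded module of the two
filtrations. -/
def bigradedDim (p q : ℕ) : ℕ :=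
  relDim ℂ (bifil f p (q + 1) ⊔ bifil f (p + 1) q) (bifil f p q)

/-- The bigraded piece is what the `p`-graded piece loses when `q` increases by one. The next lemma
exchanges the roles of `p` and `q`. -/
theorem relDim_bifil_left (p q : ℕ) :
    relDim ℂ (bifil f (p + 1) q) (bifil f p q) =
      relDim ℂ (bifil f (p + 1) (q + 1)) (bifil f p (q + 1)) + bigradedDim f p q := by
  rw [relDim_add (B := bifil f p (q + 1) ⊔ bifil f (p + 1) q) le_sup_right
    (sup_le (bifil_anti le_rfl (Nat.le_succ q)) (bifil_anti (Nat.le_succ p) le_rfl))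
    (relFinite_bifil_left p q), ← bifil_inf_bifil, inf_comm, relDim_inf,
    sup_comm (bifil f (p + 1) q) (bifil f p (q + 1))]
  rfl

theorem relDim_bifil_right (p q : ℕ) :
    relDim ℂ (bifil f p (q + 1)) (bifil f p q) =
      relDim ℂ (bifil f (p + 1) (q + 1)) (bifil f (p + 1) q) + bigradedDim f p q := by
  rw [relDim_add (B := bifil f p (q + 1) ⊔ bifil f (p + 1) q) le_sup_left
    (sup_le (bifil_anti le_rfl (Nat.le_succ q)) (bifil_anti (Nat.le_succ p) le_rfl))
    (relFinite_bifil_right p q), ← bifil_inf_bifil, relDim_inf]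
  rfl

/-- Telescoping in `q` from `q = p`, where the condition on the differential is vacuous. -/
theorem relDim_filTwo_eq_sum_add (p M : ℕ) :
    relDim ℂ (filTwo f (p + 1)) (filTwo f p) = ∑ L ∈ Finset.range M, bigradedDim f p (p + L) +
      relDim ℂ (bifil f (p + 1) (p + M)) (bifil f p (p + M)) := by
  induction M with
  | zero => simp [bifil_eq_filTwo]
  | succ M ih => rw [ih, relDim_bifil_left p (p + M), Finset.sum_range_succ]; ring_nf

theorem relDim_bifil_zero (q : ℕ) :
    relDim ℂ (bifil f 0 (q + 1)) (bifil f 0 q) =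
      ∑ p ∈ Finset.range (q + 1), bigradedDim f p q := by
  have h : ∀ m, relDim ℂ (bifil f 0 (q + 1)) (bifil f 0 q) =
      ∑ p ∈ Finset.range m, bigradedDim f p q + relDim ℂ (bifil f m (q + 1)) (bifil f m q) := by
    intro m
    induction m with
    | zero => simp
    | succ m ih => rw [ih, relDim_bifil_right m, Finset.sum_range_succ]; ring
  -- In degree `p = q + 1` both conditions on the differential are automatic, so the remainder
  -- vanishes.
  rw [h (q + 1), bifil_eq_filTwo le_rfl, bifil_eq_filTwo (Nat.le_succ q), relDim_self, add_zero]

theorem levelCycles_eq (L d : ℕ) : levelCycles f L d =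
    ((bifil f d (d + L)).submoduleOf (filTwo f d)).map (Submodule.mkQ _) := by
  rw [levelCycles]
  congr 1
  ext x
  exact ⟨fun h => ⟨x.2, h⟩, fun h => h.2⟩

theorem finrank_levelCycles (L d : ℕ) : Module.finrank ℂ (levelCycles f L d) =
    relDim ℂ (bifil f (d + 1) (d + L)) (bifil f d (d + L)) := by
  rw [levelCycles_eq, finrank_map_mkQ (bifil_le_filTwo _ _), filTwo_inf_bifil]

theorem finrank_levelHomology (L d : ℕ) :
    Module.finrank ℂ (LevelHomology f L d) = bigradedDim f d (d + L) := by
  change Module.finrank ℂ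
    (levelCycles f L d ⧸ (levelCycles f (L + 1) d).submoduleOf (levelCycles f L d)) = _
  rw [levelCycles_eq, levelCycles_eq]
  refine (mapMkQQuotientEquiv (A' := bifil f d (d + (L + 1)))
    (bifil_anti le_rfl (Nat.le_succ _)) (bifil_le_filTwo _ _)
    (filTwo f (d + 1))).finrank_eq.symm.trans ?_
  rw [filTwo_inf_bifil]
  rfl

/-- Given a chain `x` with `dx` of order at least `d + L`, exactness provides `v` with `dv = dx` and
order at least `d + L - n * N ≥ d + 1`. Then `x - v` is an honest cycle with the same class as `x`.
-/
theorem levelCycles_eq_limitCycles {N : ℕ}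
    (hN : ∀ i, (MvPowerSeries.X i ^ N : O n) ∈ jacobiIdeal f) {L : ℕ} (hL : n * N < L) (d : ℕ) :
    levelCycles f L d = limitCycles f d := by
  apply le_antisymm
  · rintro _ ⟨x, hx, rfl⟩
    have hx1 : koszulD f x ∈ filOne n (d + L) := hx
    obtain ⟨v, hv, hvx⟩ := exists_koszulD_eq f N hN (mem_filOne.1 hx1)
      (sum_koszulD_mul_partialD f _)
    have hv1 : v ∈ filTwo f (d + 1) := mem_filTwo.2 fun i =>
      Ideal.pow_le_pow_right (by omega) (hv i)
    have hv2 : v ∈ filTwo f d := filTwo_anti (Nat.le_succ d) hv1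
    refine ⟨x - ⟨v, hv2⟩, ?_, ?_⟩
    · change koszulD f (x - v) = 0
      rw [map_sub, hvx, sub_self]
    · refine (Submodule.Quotient.eq _).2 ?_
      change ((x : Pairs n → O n) - v) - x ∈ filTwo f (d + 1)
      rw [sub_sub_cancel_left]
      exact neg_mem hv1
  · rintro _ ⟨x, hx, rfl⟩
    refine ⟨x, ?_, rfl⟩
    have hx1 : koszulD f x = 0 := hx
    change koszulD f x ∈ filOne n (d + L)
    rw [hx1]
    exact zero_mem _

theorem subsingleton_levelHomology {N : ℕ}
    (hN : ∀ i, (MvPowerSeries.X i ^ N : O n) ∈ jacobiIdeal f) {L : ℕ} (hL : n * N < L) (d : ℕ) :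
    Subsingleton (LevelHomology f L d) := by
  rw [LevelHomology, levelCycles_eq_limitCycles hN hL,
    levelCycles_eq_limitCycles hN (hL.trans (Nat.lt_succ_self L)),
    Submodule.Quotient.subsingleton_iff]
  exact Submodule.submoduleOf_self _

end Filtration

end

/-! ### Recursions for the Milnor and Tjurina numbers. -/

section

variable {n : ℕ} {f : MvPolynomial (Fin n) ℂ}

variable (f) in
/-- The map from the Koszul 1-chains to the ring. -/
def augmentation : (Fin n → O n) →ₗ[O n] O n :=
  ∑ i, (LinearMap.proj i : (Fin n → O n) →ₗ[O n] O n).smulRight (partialD f i)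

theorem augmentation_apply (x : Fin n → O n) :
    augmentation f x = ∑ i, x i * partialD f i := by
  simp [augmentation, LinearMap.sum_apply]

theorem map_augmentation_filOne (k : ℕ) :
    (filOne n k).map (augmentation f) = maxIdeal n ^ k * jacobiIdeal f := by
  ext g
  rw [← smul_eq_mul, jacobiIdeal, Ideal.span, Submodule.mem_ideal_smul_span_iff_exists_sum]
  constructor
  · rintro ⟨x, hx, rfl⟩
    refine ⟨Finsupp.equivFunOnFinite.symm x, mem_filOne.1 hx, ?_⟩
    rw [Finsupp.sum_fintype _ _ (by simp), augmentation_apply]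
    rfl
  · rintro ⟨a, ha, rfl⟩
    refine ⟨a, mem_filOne.2 ha, ?_⟩
    rw [Finsupp.sum_fintype _ _ (by simp), augmentation_apply]
    rfl

theorem ker_augmentation {N : ℕ} (hN : ∀ i, (MvPowerSeries.X i ^ N : O n) ∈ jacobiIdeal f) :
    LinearMap.ker (augmentation f) = LinearMap.range (koszulD f) := by
  ext z
  rw [LinearMap.mem_ker, augmentation_apply]
  constructor
  · intro h
    obtain ⟨v, -, hv⟩ := exists_koszulD_eq f N hN (q := 0) (z := z) (by simp) h
    exact ⟨v, hv⟩
  · rintro ⟨v, rfl⟩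
    exact sum_koszulD_mul_partialD f v

theorem relFinite_maxIdeal_pow_mul_jacobiIdeal {N : ℕ}
    (hN : ∀ i, (MvPowerSeries.X i ^ N : O n) ∈ jacobiIdeal f) (k : ℕ) :
    RelFinite ℂ (maxIdeal n ^ k * jacobiIdeal f) ⊤ := by
  refine (relFinite_maxIdeal_pow (k + (n * N + 1))).right ?_
  rw [pow_add]
  exact Ideal.mul_mono_right (maxIdeal_pow_le_of_X_pow_mem hN)

theorem milnorNumber_eq (k : ℕ) :
    milnorNumber f k = relDim ℂ (maxIdeal n ^ k * jacobiIdeal f) ⊤ :=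
  (relDim_eq_finrank_quotient _).symm

theorem maxIdeal_pow_succ_mul_le (k : ℕ) :
    maxIdeal n ^ (k + 1) * jacobiIdeal f ≤ maxIdeal n ^ k * jacobiIdeal f :=
  Ideal.mul_mono_left (Ideal.pow_le_pow_right (Nat.le_succ k))

theorem relDim_bifil_zero_left {N : ℕ}
    (hN : ∀ i, (MvPowerSeries.X i ^ N : O n) ∈ jacobiIdeal f) (k : ℕ) :
    relDim ℂ (bifil f 0 (k + 1)) (bifil f 0 k) = relDim ℂ (filOne n (k + 1))
      (filOne n (k + 1) ⊔ (filOne n k ⊓ LinearMap.ker (augmentation f))) := by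
  rw [← comap_inf_bifil, relDim_comap_inf, ker_augmentation hN, bifil, filTwo_zero, top_inf_eq,
    Submodule.map_comap_eq, inf_comm]

/-- The `k`-th graded piece of the 1-chains maps onto `m^k J / m^(k+1) J`, with kernel the graded
piece of the relations among the `f_i`. These are the Koszul boundaries, whose graded piece is the
one measured by `bifil f 0`. -/
theorem milnorNumber_succ_add {N : ℕ}
    (hN : ∀ i, (MvPowerSeries.X i ^ N : O n) ∈ jacobiIdeal f) (k : ℕ) :
    milnorNumber f (k + 1) + relDim ℂ (bifil f 0 (k + 1)) (bifil f 0 k) =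
      milnorNumber f k + n * (exponents n k).card := by
  set Y := filOne n (k + 1) ⊔ (filOne n k ⊓ LinearMap.ker (augmentation f)) with hY
  have h1 : relDim ℂ Y (filOne n k) =
      relDim ℂ (maxIdeal n ^ (k + 1) * jacobiIdeal f) (maxIdeal n ^ k * jacobiIdeal f) := by
    have h2 := relDim_comap_inf (K := ℂ) (augmentation f) (maxIdeal n ^ (k + 1) * jacobiIdeal f)
      (filOne n k)
    rw [map_augmentation_filOne, sup_eq_right.2 (maxIdeal_pow_succ_mul_le k)] at h2
    rw [← h2, ← map_augmentation_filOne, Submodule.comap_map_eq, sup_inf_assoc_of_le, inf_comm]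
    exact filOne_anti (Nat.le_succ k)
  have h3 := relDim_add (B := Y) le_sup_left (sup_le (filOne_anti (Nat.le_succ k)) inf_le_left)
    (relFinite_filOne (n := n) k)
  have h4 := relDim_add (maxIdeal_pow_succ_mul_le (f := f) k) le_top
    (relFinite_maxIdeal_pow_mul_jacobiIdeal hN (k + 1))
  rw [relDim_filOne, ← relDim_bifil_zero_left hN, h1] at h3
  rw [milnorNumber_eq, milnorNumber_eq, h4]
  omega

theorem partialD_mem_maxIdeal_pow {s : ℕ} (hf : (f : O n) ∈ maxIdeal n ^ s) (i : Fin n) :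
    partialD f i ∈ maxIdeal n ^ (s - 1) := by
  rw [mem_maxIdeal_pow] at hf ⊢
  intro e he
  have := hf (e + Finsupp.single i 1) (by rw [map_add, Finsupp.degree_single]; omega)
  rw [MvPolynomial.coeff_coe] at this
  rw [partialD, MvPolynomial.coeff_coe, MvPolynomial.coeff_pderiv, this]
  simp

/-- A multiple of `f` in `m^(k+1) J(f)` is a multiple by an element of `m^k`. -/
theorem mul_mem_iff (hf0 : f ≠ 0) (hfJ : (f : O n) ∈ maxIdeal n * jacobiIdeal f) (k : ℕ)
    (g : O n) : g * (f : O n) ∈ maxIdeal n ^ (k + 1) * jacobiIdeal f ↔ g ∈ maxIdeal n ^ k := by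
  constructor
  · intro h
    have hf0' : (f : O n) ≠ 0 := by rwa [Ne, MvPolynomial.coe_eq_zero_iff]
    set s := (f : O n).order.toNat with hs
    have hs' : (s : ℕ∞) = (f : O n).order := MvPowerSeries.ne_zero_iff_order_finite.1 hf0'
    -- Differentiation lowers the order by at most one, so `m^(k+1) J(f) ⊆ m^(k+s)`; additivity of
    -- the order then bounds the order of `g`.
    have hJ : jacobiIdeal f ≤ maxIdeal n ^ (s - 1) := by
      rw [jacobiIdeal, Ideal.span_le]
      rintro _ ⟨i, rfl⟩
      exact partialD_mem_maxIdeal_pow (mem_maxIdeal_pow_iff_le_order.2 hs'.le) i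
    have h1 : g * (f : O n) ∈ maxIdeal n ^ (k + s) := by
      have h2 := Ideal.mul_mono_right hJ h
      rw [← pow_add] at h2
      exact Ideal.pow_le_pow_right (by omega) h2
    rw [mem_maxIdeal_pow_iff_le_order, MvPowerSeries.order_mul, ← hs'] at h1
    rw [mem_maxIdeal_pow_iff_le_order]
    push_cast at h1
    exact (ENat.add_le_add_iff_right (ENat.natCast_ne_top s)).1 h1
  · intro h
    rw [pow_succ, mul_assoc]
    exact Ideal.mul_mem_mul h hfJ

variable (f) in
/-- The ideal `(f, m^k J(f))`. -/
abbrev tjurinaIdeal (k : ℕ) : Ideal (O n) :=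
  Ideal.span {(f : MvPowerSeries (Fin n) ℂ)} ⊔ maxIdeal n ^ k * jacobiIdeal f

theorem tjurinaNumber_eq (k : ℕ) : tjurinaNumber f k =
    relDim ℂ (tjurinaIdeal f k) ⊤ :=
  (relDim_eq_finrank_quotient _).symm

theorem tjurinaNumber_zero (hfJ : (f : O n) ∈ maxIdeal n * jacobiIdeal f) :
    tjurinaNumber f 0 = milnorNumber f 0 := by
  rw [tjurinaNumber_eq, milnorNumber_eq, tjurinaIdeal, sup_eq_right.2]
  rw [Ideal.span_singleton_le_iff_mem, pow_zero, one_mul]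
  have hle : maxIdeal n * jacobiIdeal f ≤ jacobiIdeal f := Ideal.mul_le_right
  exact hle hfJ

/-- Multiplication by `f` identifies `O / m^k` with `(f, m^(k+1) J) / m^(k+1) J`. -/
theorem milnorNumber_succ {N : ℕ} (hN : ∀ i, (MvPowerSeries.X i ^ N : O n) ∈ jacobiIdeal f)
    (hf0 : f ≠ 0) (hfJ : (f : O n) ∈ maxIdeal n * jacobiIdeal f) (k : ℕ) :
    milnorNumber f (k + 1) = tjurinaNumber f (k + 1) + relDim ℂ (maxIdeal n ^ k) ⊤ := by
  have h1 := relDim_comap_inf (K := ℂ) (LinearMap.toSpanSingleton (O n) (O n) (f : O n))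
    (maxIdeal n ^ (k + 1) * jacobiIdeal f) ⊤
  have h2 : Submodule.comap (LinearMap.toSpanSingleton (O n) (O n) (f : O n))
      (maxIdeal n ^ (k + 1) * jacobiIdeal f) = maxIdeal n ^ k := by
    ext g
    exact mul_mem_iff hf0 hfJ k g
  rw [inf_top_eq, h2, Submodule.map_top, LinearMap.range_toSpanSingleton, sup_comm] at h1
  have h3 := relDim_add (K := ℂ) (A := maxIdeal n ^ (k + 1) * jacobiIdeal f)
    (B := tjurinaIdeal f (k + 1)) le_sup_right le_top
    (relFinite_maxIdeal_pow_mul_jacobiIdeal hN (k + 1))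
  rw [tjurinaNumber_eq, milnorNumber_eq, h1, h3]
  exact Nat.add_comm _ _

theorem relDim_maxIdeal_pow_top_succ (k : ℕ) : relDim ℂ (maxIdeal n ^ (k + 1)) ⊤ =
    (exponents n k).card + relDim ℂ (maxIdeal n ^ k) ⊤ := by
  rw [relDim_add (Ideal.pow_le_pow_right (Nat.le_succ k)) le_top (relFinite_maxIdeal_pow (k + 1)),
    relDim_maxIdeal_pow_succ]

end

/-! ### Generating series. -/

section

variable {n : ℕ} {f : MvPolynomial (Fin n) ℂ}

theorem levelSeries_eq_zero {N : ℕ} (hN : ∀ i, (MvPowerSeries.X i ^ N : O n) ∈ jacobiIdeal f)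
    {L : ℕ} (hL : n * N < L) : levelSeries f L = 0 := by
  ext d
  have := subsingleton_levelHomology hN hL d
  rw [levelSeries, PowerSeries.coeff_mk, Module.finrank_zero_of_subsingleton]
  simp

theorem coeff_levelSeries (L d : ℕ) :
    PowerSeries.coeff d (levelSeries f L) = (bigradedDim f d (d + L) : ℚ) := by
  rw [levelSeries, PowerSeries.coeff_mk, finrank_levelHomology]

theorem gapNumbers_finite {N : ℕ} (hN : ∀ i, (MvPowerSeries.X i ^ N : O n) ∈ jacobiIdeal f) :
    (gapNumbers f).Finite := by
  refine (Set.finite_Iic (n * N)).subset fun L hL => ?_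
  obtain ⟨-, d, hd⟩ := hL
  by_contra h
  have := subsingleton_levelHomology hN (not_le.1 h) d
  exact not_subsingleton _ this

theorem levelSeries_eq_zero_of_notMem {L : ℕ} (h1 : 1 ≤ L) (h : L ∉ gapNumbers f) :
    levelSeries f L = 0 := by
  ext d
  have : Subsingleton (LevelHomology f L d) := by
    rw [← not_nontrivial_iff_subsingleton]
    exact fun h' => h ⟨h1, d, h'⟩
  rw [levelSeries, PowerSeries.coeff_mk, Module.finrank_zero_of_subsingleton]
  simp

/-- Replaces the gap numbers by a fixed range of levels. A positive level that is not a gap has zero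
series, and level `0`, whose series may be nonzero, is killed by the factor `X - X ^ 1`. -/
theorem sum_gapNumbers {N : ℕ} (hN : ∀ i, (MvPowerSeries.X i ^ N : O n) ∈ jacobiIdeal f)
    (hgap : (gapNumbers f).Finite) (I : PowerSeries ℚ) :
    ∑ L ∈ hgap.toFinset, (PowerSeries.X - PowerSeries.X ^ (L + 1)) * I * levelSeries f L =
      ∑ L ∈ Finset.range (n * N + 1),
        (PowerSeries.X - PowerSeries.X ^ (L + 1)) * I * levelSeries f L := by
  refine Finset.sum_subset (fun L hL => ?_) (fun L _ hL => ?_)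
  · obtain ⟨-, d, hd⟩ := hgap.mem_toFinset.1 hL
    rw [Finset.mem_range]
    by_contra h
    have := subsingleton_levelHomology hN (show n * N < L by omega) d
    exact not_subsingleton _ this
  · rw [Set.Finite.mem_toFinset] at hL
    rcases Nat.eq_zero_or_pos L with rfl | h
    · simp
    · rw [levelSeries_eq_zero_of_notMem h hL, mul_zero]

/-- The Hilbert series of the associated graded module of the 2-chains. -/
theorem sum_levelSeries_add_limitSeries {N : ℕ}
    (hN : ∀ i, (MvPowerSeries.X i ^ N : O n) ∈ jacobiIdeal f) :
    ∑ L ∈ Finset.range (n * N + 1), levelSeries f L + limitSeries f =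
      hilbertSeries n * ∑ p : Pairs n, PowerSeries.X ^ multPair f p := by
  ext d
  rw [map_add, map_sum, Finset.mul_sum, map_sum]
  simp only [coeff_levelSeries, PowerSeries.coeff_mul_X_pow']
  have h := relDim_filTwo_eq_sum_add (f := f) d (n * N + 1)
  rw [relDim_filTwo, ← finrank_levelCycles, levelCycles_eq_limitCycles hN (Nat.lt_succ_self _)] at h
  rw [limitSeries, PowerSeries.coeff_mk]
  simp only [hilbertSeries, PowerSeries.coeff_mk]
  exact_mod_cast h.symm

variable (f) in
/-- The Hilbert series of the associated graded module of the image of the Koszul differential. -/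
def boundarySeries : PowerSeries ℚ :=
  PowerSeries.mk fun q => (relDim ℂ (bifil f 0 (q + 1)) (bifil f 0 q) : ℚ)

theorem boundarySeries_eq {N : ℕ} (hN : ∀ i, (MvPowerSeries.X i ^ N : O n) ∈ jacobiIdeal f) :
    boundarySeries f =
      ∑ L ∈ Finset.range (n * N + 1), PowerSeries.X ^ L * levelSeries f L := by
  ext q
  have hzero : ∀ L d, n * N < L → bigradedDim f d (d + L) = 0 := fun L d hL => by
    have := coeff_levelSeries (f := f) L d
    rw [levelSeries_eq_zero hN hL, map_zero] at this
    exact_mod_cast this.symm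
  -- Reflecting the sum over `p` indexes it by the level `L = q - p`; the piece `(q - L, q)` is the
  -- coefficient of `t^q` in `t^L H_L`.
  rw [boundarySeries, PowerSeries.coeff_mk, relDim_bifil_zero, map_sum,
    ← Finset.sum_range_reflect]
  simp only [PowerSeries.coeff_X_pow_mul', coeff_levelSeries]
  push_cast
  have h1 : ∀ L ∈ Finset.range (q + 1), (bigradedDim f (q - L) q : ℚ) =
      if L ≤ q then (bigradedDim f (q - L) (q - L + L) : ℚ) else 0 := by
    intro L hL
    rw [Finset.mem_range, Nat.lt_succ_iff] at hL
    rw [if_pos hL, Nat.sub_add_cancel hL]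
  rw [Finset.sum_congr rfl h1]
  rcases le_total (q + 1) (n * N + 1) with h | h
  · refine Finset.sum_subset (Finset.range_subset_range.2 h) fun L _ hL => ?_
    rw [Finset.mem_range] at hL
    exact if_neg (by omega)
  · refine (Finset.sum_subset (Finset.range_subset_range.2 h) fun L _ hL => ?_).symm
    rw [Finset.mem_range] at hL
    rw [hzero L (q - L) (by omega), Nat.cast_zero, ite_self]

theorem milnorSeries_mul {N : ℕ} (hN : ∀ i, (MvPowerSeries.X i ^ N : O n) ∈ jacobiIdeal f) :
    milnorSeries f * (1 - PowerSeries.X) = (milnorNumber f 0 : PowerSeries ℚ) +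
      PowerSeries.X * ((n : PowerSeries ℚ) * hilbertSeries n - boundarySeries f) := by
  have hC : ∀ m : ℕ, (m : PowerSeries ℚ) = PowerSeries.C (m : ℚ) := fun m => (map_natCast _ m).symm
  rw [mul_sub, mul_one, hC, hC]
  ext k
  rcases k with _ | k
  · simp [milnorSeries]
  · rw [map_sub, map_add, mul_comm PowerSeries.X (_ - _), PowerSeries.coeff_succ_mul_X,
      PowerSeries.coeff_succ_mul_X, map_sub, PowerSeries.coeff_C_mul, PowerSeries.coeff_C,
      if_neg (Nat.succ_ne_zero k)]
    simp only [milnorSeries, hilbertSeries, boundarySeries, PowerSeries.coeff_mk]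
    have h := milnorNumber_succ_add hN k
    have h' : (milnorNumber f (k + 1) : ℚ) + relDim ℂ (bifil f 0 (k + 1)) (bifil f 0 k) =
      milnorNumber f k + n * (exponents n k).card := by exact_mod_cast h
    linear_combination h'

/-- One factor `X` is the index shift between `μ_(k+1) - τ_(k+1)` and `dim O/m^k`; the other comes
from summing the Hilbert function to get `dim O/m^k`. -/
theorem milnorSeries_sub_tjurinaSeries_mul {N : ℕ}
    (hN : ∀ i, (MvPowerSeries.X i ^ N : O n) ∈ jacobiIdeal f) (hf0 : f ≠ 0)
    (hfJ : (f : O n) ∈ maxIdeal n * jacobiIdeal f) :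
    (milnorSeries f - tjurinaSeries f) * (1 - PowerSeries.X) =
      PowerSeries.X * (PowerSeries.X * hilbertSeries n) := by
  have h1 : milnorSeries f - tjurinaSeries f =
      (PowerSeries.mk fun k => (relDim ℂ (maxIdeal n ^ k) ⊤ : ℚ)) * PowerSeries.X := by
    ext k
    rcases k with _ | k
    · simp [milnorSeries, tjurinaSeries, tjurinaNumber_zero hfJ]
    · rw [map_sub, PowerSeries.coeff_succ_mul_X]
      simp only [milnorSeries, tjurinaSeries, PowerSeries.coeff_mk, milnorNumber_succ hN hf0 hfJ]
      push_cast
      ring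
  have h2 : (PowerSeries.mk fun k => (relDim ℂ (maxIdeal n ^ k) ⊤ : ℚ)) * (1 - PowerSeries.X) =
      PowerSeries.X * hilbertSeries n := by
    rw [mul_sub, mul_one, mul_comm PowerSeries.X]
    ext k
    rcases k with _ | k
    · simp [Ideal.one_eq_top, relDim_self]
    · rw [map_sub, PowerSeries.coeff_succ_mul_X, PowerSeries.coeff_succ_mul_X]
      simp only [hilbertSeries, PowerSeries.coeff_mk, relDim_maxIdeal_pow_top_succ]
      push_cast
      ring
  rw [h1, mul_right_comm, h2, mul_comm]

end

end KthTjurina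

end

theorem theoremC (n : ℕ) (hn : 1 ≤ n) (w : Fin n → ℚ) (hw : ∀ i, 0 < w i) (W : ℚ)
    (f : MvPolynomial (Fin n) ℂ) (hf : MvPolynomial.IsWeightedHomogeneous w f W)
    (hsing : KthTjurina.HasIsolatedSingularity f) :
    (∀ k, Module.Finite ℂ (KthTjurina.MilnorAlgebra f k)) ∧
    (∀ k, Module.Finite ℂ (KthTjurina.TjurinaAlgebra f k)) ∧
    (∀ d, Module.Finite ℂ (KthTjurina.GrTwo f d)) ∧
    ∃ hgap : (KthTjurina.gapNumbers f).Finite,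
      KthTjurina.milnorSeries f =
        PowerSeries.X * ((1 - PowerSeries.X) ^ (n + 1))⁻¹ *
            ((n : PowerSeries ℚ)
              - ∑ p : KthTjurina.Pairs n, PowerSeries.X ^ KthTjurina.multPair f p)
          + ((KthTjurina.milnorNumber f 0 : PowerSeries ℚ)
              + KthTjurina.limitSeries f * PowerSeries.X) * (1 - PowerSeries.X)⁻¹
          + ∑ L ∈ hgap.toFinset,
              (PowerSeries.X - PowerSeries.X ^ (L + 1)) * (1 - PowerSeries.X)⁻¹
                * KthTjurina.levelSeries f L ∧
      KthTjurina.tjurinaSeries f =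
        PowerSeries.X * ((1 - PowerSeries.X) ^ (n + 1))⁻¹ *
            ((n : PowerSeries ℚ) - PowerSeries.X
              - ∑ p : KthTjurina.Pairs n, PowerSeries.X ^ KthTjurina.multPair f p)
          + ((KthTjurina.milnorNumber f 0 : PowerSeries ℚ)
              + KthTjurina.limitSeries f * PowerSeries.X) * (1 - PowerSeries.X)⁻¹
          + ∑ L ∈ hgap.toFinset,
              (PowerSeries.X - PowerSeries.X ^ (L + 1)) * (1 - PowerSeries.X)⁻¹
                * KthTjurina.levelSeries f L := by

  have hW := KthTjurina.weight_pos hn hw hf hsing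
  have hf0 := KthTjurina.ne_zero_of_hasIsolatedSingularity hn hsing
  have hfJ := KthTjurina.mem_maxIdeal_mul_jacobiIdeal hW hf
  obtain ⟨N, hN⟩ := KthTjurina.exists_X_pow_mem_jacobiIdeal hw hW hf hsing
  have hfin := KthTjurina.relFinite_maxIdeal_pow_mul_jacobiIdeal hN
  refine ⟨fun k => (KthTjurina.relFinite_top_iff _).1 (hfin k), fun k =>
    (KthTjurina.relFinite_top_iff (KthTjurina.tjurinaIdeal f k)).1 ((hfin k).right le_sup_right),
    KthTjurina.relFinite_filTwo f, KthTjurina.gapNumbers_finite hN, ?_⟩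
  have hgap := KthTjurina.gapNumbers_finite hN
  rw [KthTjurina.sum_gapNumbers hN hgap]
  set X : PowerSeries ℚ := PowerSeries.X with hX
  set I : PowerSeries ℚ := (1 - X)⁻¹ with hI
  set G := KthTjurina.hilbertSeries n with hG
  have hXI : (1 - X) * I = 1 := PowerSeries.mul_inv_cancel _ (by simp [hX])
  have hXG : G * (1 - X) ^ n = 1 := KthTjurina.hilbertSeries_mul hn
  have hinv : ((1 - X) ^ (n + 1))⁻¹ = G * I := by
    rw [PowerSeries.inv_eq_iff_mul_eq_one (by simp [hX])]
    calc G * I * (1 - X) ^ (n + 1) = (G * (1 - X) ^ n) * ((1 - X) * I) := by ring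
      _ = 1 := by rw [hXG, hXI, one_mul]
  have hM := KthTjurina.milnorSeries_mul hN
  rw [KthTjurina.boundarySeries_eq hN] at hM
  have hT := KthTjurina.milnorSeries_sub_tjurinaSeries_mul hN hf0 hfJ
  have hS := KthTjurina.sum_levelSeries_add_limitSeries hN
  rw [hinv]
  have hsum : ∑ L ∈ Finset.range (n * N + 1),
      (X - X ^ (L + 1)) * I * KthTjurina.levelSeries f L =
      X * I * ∑ L ∈ Finset.range (n * N + 1), KthTjurina.levelSeries f L -
      X * I * ∑ L ∈ Finset.range (n * N + 1), X ^ L * KthTjurina.levelSeries f L := by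
    rw [Finset.mul_sum, Finset.mul_sum, ← Finset.sum_sub_distrib]
    exact Finset.sum_congr rfl fun L _ => by ring
  rw [hsum]
  have hMs : KthTjurina.milnorSeries f = X * (G * I) * ((n : PowerSeries ℚ)
        - ∑ p : KthTjurina.Pairs n, X ^ KthTjurina.multPair f p)
      + ((KthTjurina.milnorNumber f 0 : PowerSeries ℚ) + KthTjurina.limitSeries f * X) * I
      + (X * I * ∑ L ∈ Finset.range (n * N + 1), KthTjurina.levelSeries f L -
        X * I * ∑ L ∈ Finset.range (n * N + 1), X ^ L * KthTjurina.levelSeries f L) := by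
    -- Divide the recursion `hM` by `1 - X`, then use `hS` to trade the Hilbert series of the
    -- 2-chains for the level series and the limit series.
    linear_combination (-KthTjurina.milnorSeries f) * hXI + I * hM - X * I * hS
  refine ⟨hMs, ?_⟩
  linear_combination hMs - I * hT +
    (KthTjurina.milnorSeries f - KthTjurina.tjurinaSeries f) * hXI
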